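/- **Setting.** Let $(X,\omega)$ be a symplectic manifold of dimension $2n+2$ with pairwise disjoint concave ends $E_a$ $(a\in A)$: $E_a\subset X$ is open and is identified, by a symplectic diffeomorphism, with $((-\infty,R_a)\times M_a,\ d(e^{\alpha}\lambda_a))$, where $M_a$ is a compact manifold of dimension $2n+1$ with contact form $\lambda_a$, and $(-\infty,d]\times M_a$ is closed in $X$ for every $d<R_a$. Let $L_0,L_1\subset X$ be Lagrangian submanifolds which intersect transversally and satisfy $L_j\cap E_a=(-\infty,R_a)\times\Lambda_j^a$ with Legendrian submanifolds $\Lambda_j^a\subset M_a$. Let $J_t$, $t\in[0,1]$, be a smooth family of almost complex structures on $X$ such that $\omega(\cdot,J_t\cdot)$ is a Riemannian metric and such that on each end $J_t(c\,\partial_\alpha+b\,X_{\lambda_a}+k)=-b\,\partial_\alpha+c\,X_{\lambda_a}+I_tk$ for $c,b\in\mathbb R$ and $k\in\xi_a=\ker\lambda_a$. Here $X_{\lambda_a}$ is the Reeb vector field and $I_t$ is a complex structure on $\xi_a$ for which $d\lambda_a(\cdot,I_t\cdot)$ is an inner product. On an end we write $\bar u=(\alpha,u)$. **Strips.** A pseudo-holomorphic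 strip is a smooth map $\bar u:\mathbb R\times[0,1]\to X$ with $\partial_\tau\bar u+J_t(\bar u)\,\partial_t\bar u=0$, $\bar u(\mathbb R,0)\subset L_0$ and $\bar u(\mathbb R,1)\subset L_1$. Consider the following asymptotic conditions, with limits uniform in $t\in[0,1]$: * $(p_\pm)$: $\bar u(\tau,t)$ tends to a point of $L_0\cap L_1$ as $\tau\to\pm\infty$; * $(\gamma_-)$: as $\tau\to-\infty$, $\bar u$ lies in some end $E_a$, $\alpha(\tau,t)\to-\infty$ and $u(\tau,t)\to\gamma(Tt)$ for a Reeb chord $\gamma:[0,T]\to M_a$, $T>0$, from $\Lambda^a_0$ to $\Lambda^a_1$; * $(\gamma_+)$: as $\tau\to+\infty$, $\bar u$ lies in some end $E_a$, $\alpha(\tau,t)\to-\infty$ and $u(\tau,t)\to\gamma(T(1-t))$ for a Reeb chord $\gamma:[0,T]\to M_a$, $T>0$, from $\Lambda^a_1$ to $\Lambda^a_0$. The strip is of type (I) if $(p_-)$ and $(p_+)$ hold, of type (II) if $(\gamma_-)$ and $(p_+)$ hold, of type (II$'$) if $(p_-)$ and $(\gamma_+)$ hold, and of type (III) if $(\gamma_-)$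 and $(\gamma_+)$ hold. **Limits in an end.** Let $\bar u_i$ be a sequence of pseudo-holomorphic strips and fix an end $E=(-\infty,R)\times M$ with contact form $\lambda$. A map $\bar v:\Sigma\to\mathbb R\times M$ is called a limit of $(\bar u_i)$ in $E$ if, after passing to a subsequence, there are points $q_i\in\mathbb R\times[0,1]\subset\mathbb C$ and radii $\delta_i>0$ with $\bar u_i(z)\in E$ for all $z\in\mathbb R\times[0,1]$ with $|z-q_i|<\delta_i$ and with $\alpha_i(q_i)\to-\infty$, such that the maps $(\alpha_i\circ\phi_i-\alpha_i(q_i),\,u_i\circ\phi_i)$ converge to $\bar v$ in $C^\infty_{loc}$ on $\Sigma$, where one of the following holds: * (interior rescaling) $\Sigma=\mathbb C$, $\phi_i(z)=q_i+z/m_i$, $\delta_i\to0$, $m_i>0$, $\delta_im_i\to\infty$ and $\{|z-q_i|<\delta_i\}\subset\mathbb R\times(0,1)$; * (boundary rescaling) $\Sigma=\{\operatorname{Im}z\ge0\}$, $\delta_i\to0$, $m_i>0$, $\delta_im_i\to\infty$, and either $\phi_i(z)=\operatorname{Re}q_i+z/m_i$ with $m_i\operatorname{Im}q_i$ bounded,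 or $\phi_i(z)=\operatorname{Re}q_i+\sqrt{-1}-z/m_i$ with $m_i(1-\operatorname{Im}q_i)$ bounded; * (translation) $\Sigma=\mathbb R\times[0,1]$, $\phi_i(z)=z+\operatorname{Re}q_i$ and $\delta_i\to\infty$. The scaling factors $m_i$ are arbitrary; for example $m_i=|\nabla\bar u_i(q_i)|$. **Hofer energy.** Let $\Phi$ be the set of smooth functions $\varphi:\mathbb R\to[0,1]$ with $\varphi'\ge0$, and put $E_\Phi(\bar v)=\sup_{\varphi\in\Phi}\int_\Sigma\bar v^*d(\varphi\lambda)$, where $\varphi=\varphi(\alpha)$. **Proposition 5.11.** Let $(\bar u_i)$ be a sequence of pseudo-holomorphic strips, each of type (I), (II), (II$'$) or (III), and let $C\ge0$ be a constant with $\int_{\mathbb R\times[0,1]}\bar u_i^*\omega\le C$ for all $i$. If $\bar v$ is a limit of $(\bar u_i)$ in a concave end $(-\infty,R)\times M$ as above, then $$E_\Phi(\bar v)\le e^{-R}\,C .$$ -/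

import Mathlib

open Set Filter MeasureTheory
open scoped Manifold ContDiff Topology ENNReal NNReal

noncomputable section

namespace ConcaveEnds

/-! ### Differential forms and submanifolds -/

section Forms

variable {m : ℕ} {N : Type*} [TopologicalSpace N] [ChartedSpace (EuclideanSpace ℝ (Fin m)) N]

/-- A (not necessarily smooth) differential `k`-form on the `m`-manifold `N`. -/
abbrev DiffForm (m : ℕ) (N : Type*) [TopologicalSpace N]
    [ChartedSpace (EuclideanSpace ℝ (Fin m)) N] (k : ℕ) : Type _ :=
  ∀ x : N, TangentSpace (𝓡 m) x [⋀^Fin k]→L[ℝ] ℝ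

/-- The form `η` read in the preferred chart at `x`: its pullback under the inverse chart. -/
def formInChart {k : ℕ} (η : DiffForm m N k) (x : N) (y : EuclideanSpace ℝ (Fin m)) :
    EuclideanSpace ℝ (Fin m) [⋀^Fin k]→L[ℝ] ℝ :=
  (η ((extChartAt (𝓡 m) x).symm y)).compContinuousLinearMap
    (mfderiv 𝓘(ℝ, EuclideanSpace ℝ (Fin m)) (𝓡 m) (extChartAt (𝓡 m) x).symm y)

/-- Smoothness of a differential form, in charts. -/
def IsSmoothForm {k : ℕ} (η : DiffForm m N k) : Prop :=
  ∀ x : N, ContDiffOn ℝ ∞ (formInChart η x) (extChartAt (𝓡 m) x).target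

/-- The exterior derivative `dη`, computed in the preferred chart at each point. -/
def extD {k : ℕ} (η : DiffForm m N k) : DiffForm m N (k + 1) := fun x =>
  (extDeriv (formInChart η x) (extChartAt (𝓡 m) x x)).compContinuousLinearMap
    (mfderiv (𝓡 m) 𝓘(ℝ, EuclideanSpace ℝ (Fin m)) (extChartAt (𝓡 m) x) x)

/-- Embedded `d`-dimensional smooth submanifolds (without boundary): around each point of `L`
there is a smooth chart in which `L` is a `d`-dimensional linear subspace. -/
def IsSubmanifold (m d : ℕ) {N : Type*} [TopologicalSpace N]
    [ChartedSpace (EuclideanSpace ℝ (Fin m)) N] (L : Set N) : Prop :=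
  ∀ x ∈ L, ∃ e ∈ IsManifold.maximalAtlas (𝓡 m) ∞ N, x ∈ e.source ∧
    ∃ V : Submodule ℝ (EuclideanSpace ℝ (Fin m)), Module.finrank ℝ V = d ∧
      ∀ y ∈ e.source, y ∈ L ↔ e y ∈ V

/-- The tangent vectors of `L` at `x`: velocities at time `0` of curves in `L` through `x`. -/
def tangentVectors (m : ℕ) {N : Type*} [TopologicalSpace N]
    [ChartedSpace (EuclideanSpace ℝ (Fin m)) N] (L : Set N) (x : N) :
    Set (TangentSpace (𝓡 m) x) :=
  {w | ∃ c : ℝ → N, ∃ h : c 0 = x, (∀ᶠ s in 𝓝 (0 : ℝ), c s ∈ L) ∧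
    HasMFDerivAt 𝓘(ℝ, ℝ) (𝓡 m) c 0
      (ContinuousLinearMap.toSpanSingleton ℝ (h ▸ w : TangentSpace (𝓡 m) (c 0)))}

/-- Symplectic forms: smooth, closed and non-degenerate `2`-forms. -/
structure IsSymplecticForm (Om : DiffForm m N 2) : Prop where
  smooth : IsSmoothForm Om
  closed : ∀ x, extD Om x = 0
  nondegenerate : ∀ x (v : TangentSpace (𝓡 m) x), v ≠ 0 →
    ∃ w : TangentSpace (𝓡 m) x, Om x ![v, w] ≠ 0

/-- Contact forms on a manifold of dimension `2n+1`: smooth `1`-forms `lam` which vanish nowhere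
and for which `d lam` is non-degenerate on the kernel of `lam`, i.e. `lam ∧ (d lam)^n` is a
volume form. -/
structure IsContactForm (lam : DiffForm m N 1) : Prop where
  smooth : IsSmoothForm lam
  ne_zero : ∀ x, lam x ≠ 0
  nondegenerate : ∀ x (h : TangentSpace (𝓡 m) x), lam x ![h] = 0 → h ≠ 0 →
    ∃ k : TangentSpace (𝓡 m) x, lam x ![k] = 0 ∧ extD lam x ![h, k] ≠ 0

/-- Lagrangian submanifolds of the symplectic manifold `(N, Om)` of dimension `m = 2d`. -/
structure IsLagrangian (d : ℕ) (Om : DiffForm m N 2) (L : Set N) : Prop where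
  submanifold : IsSubmanifold m d L
  isotropic : ∀ x ∈ L, ∀ v ∈ tangentVectors m L x, ∀ w ∈ tangentVectors m L x, Om x ![v, w] = 0

/-- Legendrian submanifolds of the contact manifold `(N, lam)` of dimension `m = 2d+1`. -/
structure IsLegendrian (d : ℕ) (lam : DiffForm m N 1) (L : Set N) : Prop where
  submanifold : IsSubmanifold m d L
  tangent : ∀ x ∈ L, ∀ v ∈ tangentVectors m L x, lam x ![v] = 0

/-- `r` is the value at `x` of the Reeb vector field of `lam`. -/
def IsReebVector (lam : DiffForm m N 1) (x : N) (r : TangentSpace (𝓡 m) x) : Prop :=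
  lam x ![r] = 1 ∧ ∀ h : TangentSpace (𝓡 m) x, extD lam x ![r, h] = 0

/-- `γ : [0,T] → N` is a Reeb chord of length `T` from `S₀` to `S₁`. -/
structure IsReebChord (lam : DiffForm m N 1) (S₀ S₁ : Set N) (T : ℝ) (γ : ℝ → N) : Prop where
  pos : 0 < T
  velocity : ∀ s ∈ Icc 0 T, ∃ r : TangentSpace (𝓡 m) (γ s), IsReebVector lam (γ s) r ∧
    HasMFDerivWithinAt 𝓘(ℝ, ℝ) (𝓡 m) γ (Icc 0 T) s (ContinuousLinearMap.toSpanSingleton ℝ r)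
  start : γ 0 ∈ S₀
  finish : γ T ∈ S₁

/-- The value of the `2`-form `d(f lam) = f'(α) dα ∧ lam + f(α) d lam` on `ℝ × N` at the
point `p = (α, x)` on the tangent vectors `v` and `w` of `ℝ × N`. -/
def dScaled (f : ℝ → ℝ) (lam : DiffForm m N 1) (p : ℝ × N)
    (v w : ℝ × TangentSpace (𝓡 m) p.2) : ℝ :=
  deriv f p.1 * (v.1 * lam p.2 ![w.2] - w.1 * lam p.2 ![v.2]) + f p.1 * extD lam p.2 ![v.2, w.2]

/-- A complex structure `I` on the contact hyperplane field `ξ = ker lam` for which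
`d lam (h, I k)` is an inner product on `ξ` (the values of `I` off `ξ` play no role). -/
structure IsContactComplexStructure (lam : DiffForm m N 1)
    (I : ∀ x : N, TangentSpace (𝓡 m) x →L[ℝ] TangentSpace (𝓡 m) x) : Prop where
  preserves : ∀ x (k : TangentSpace (𝓡 m) x), lam x ![k] = 0 → lam x ![I x k] = 0
  sq : ∀ x (k : TangentSpace (𝓡 m) x), lam x ![k] = 0 → I x (I x k) = -k
  symm : ∀ x (h k : TangentSpace (𝓡 m) x), lam x ![h] = 0 → lam x ![k] = 0 →
    extD lam x ![h, I x k] = extD lam x ![k, I x h]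
  pos : ∀ x (k : TangentSpace (𝓡 m) x), lam x ![k] = 0 → k ≠ 0 → 0 < extD lam x ![k, I x k]

/-- A time-dependent almost complex structure `J t`, `t ∈ [0,1]`, smooth in `(t, x)`, such that
`Om(·, J t ·)` is a Riemannian metric for each `t`. -/
structure IsCompatibleFamily [IsManifold (𝓡 m) ∞ N] (Om : DiffForm m N 2)
    (J : ℝ → ∀ x : N, TangentSpace (𝓡 m) x →L[ℝ] TangentSpace (𝓡 m) x) : Prop where
  smooth : ContMDiffOn (𝓘(ℝ, ℝ).prod (𝓡 m))
    ((𝓡 m).prod 𝓘(ℝ, EuclideanSpace ℝ (Fin m) →L[ℝ] EuclideanSpace ℝ (Fin m))) ∞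
    (fun q : ℝ × N => Bundle.TotalSpace.mk' (EuclideanSpace ℝ (Fin m) →L[ℝ]
      EuclideanSpace ℝ (Fin m)) (E := fun x : N => TangentSpace (𝓡 m) x →L[ℝ]
        TangentSpace (𝓡 m) x) q.2 (J q.1 q.2))
    (Icc 0 1 ×ˢ univ)
  sq : ∀ t ∈ Icc (0 : ℝ) 1, ∀ x (v : TangentSpace (𝓡 m) x), J t x (J t x v) = -v
  symm : ∀ t ∈ Icc (0 : ℝ) 1, ∀ x (v w : TangentSpace (𝓡 m) x),
    Om x ![v, J t x w] = Om x ![w, J t x v]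
  pos : ∀ t ∈ Icc (0 : ℝ) 1, ∀ x (v : TangentSpace (𝓡 m) x), v ≠ 0 → 0 < Om x ![v, J t x v]

end Forms

/-! ### Maps on domains of the complex plane -/

/-- The strip `ℝ × [0,1]`, with coordinate `z = τ + i t`. -/
def strip : Set ℂ := {z | z.im ∈ Icc (0 : ℝ) 1}

/-- The closed upper half plane. -/
def halfPlane : Set ℂ := {z | 0 ≤ z.im}

section Maps

variable {m : ℕ} {N : Type*} [TopologicalSpace N] [ChartedSpace (EuclideanSpace ℝ (Fin m)) N]

/-- The partial derivative at `z` in the direction `ζ` of a map `u : D → N`, `D ⊆ ℂ`; the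
directions `1` and `i` give `∂u/∂τ` and `∂u/∂t`. -/
def partialD (m : ℕ) {N : Type*} [TopologicalSpace N]
    [ChartedSpace (EuclideanSpace ℝ (Fin m)) N] (D : Set ℂ) (u : ℂ → N) (z ζ : ℂ) :
    TangentSpace (𝓡 m) (u z) :=
  mfderivWithin 𝓘(ℝ, ℂ) (𝓡 m) u D z ζ

/-- The partial derivative at `z` in the direction `ζ` of a map `v = (b, w) : D → ℝ × N`. -/
def partialDPair (D : Set ℂ) (v : ℂ → ℝ × N) (z ζ : ℂ) :
    ℝ × TangentSpace (𝓡 m) (v z).2 :=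
  (fderivWithin ℝ (fun y => (v y).1) D z ζ, partialD m D (fun y => (v y).2) z ζ)

/-- The symplectic energy `∫ u^*Om` of a map `u : ℝ × [0,1] → N` whose density `Om(u_τ, u_t)` is
non-negative, as it is for pseudo-holomorphic strips. -/
def symplecticEnergy (Om : DiffForm m N 2) (u : ℂ → N) : ℝ≥0∞ :=
  ∫⁻ z in strip, ENNReal.ofReal (Om (u z) ![partialD m strip u z 1, partialD m strip u z Complex.I])

/-- The class `Φ` of smooth functions `φ : ℝ → [0,1]` with `φ' ≥ 0`. -/
def monotoneCutoffs : Set (ℝ → ℝ) :=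
  {φ | ContDiff ℝ ∞ φ ∧ (∀ s, φ s ∈ Icc (0 : ℝ) 1) ∧ ∀ s, 0 ≤ deriv φ s}

/-- The Hofer energy `sup_{φ ∈ Φ} ∫_D v^* d(φ lam)` of a map `v : D → ℝ × N`; the density of
`v^* d(φ lam)` is non-negative if `v` is pseudo-holomorphic. -/
def hoferEnergy (lam : DiffForm m N 1) (D : Set ℂ) (v : ℂ → ℝ × N) : ℝ≥0∞ :=
  ⨆ φ ∈ monotoneCutoffs, ∫⁻ z in D, ENNReal.ofReal
    (dScaled φ lam (v z) (partialDPair D v z 1) (partialDPair D v z Complex.I))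

/-- Convergence in the `C^∞_loc` topology on `D ⊆ ℂ` of maps `f k`, each defined on a part of `D`
(every point of `D` having a neighbourhood on which almost all of them are defined), to a smooth
map `v : D → ℝ × N`: near each point and in the chart of `ℝ × N` at its image, all derivatives
converge uniformly. -/
def ConvergesSmoothly (m : ℕ) {N : Type*} [TopologicalSpace N]
    [ChartedSpace (EuclideanSpace ℝ (Fin m)) N] (D : Set ℂ) (f : ℕ → ℂ → ℝ × N)
    (v : ℂ → ℝ × N) : Prop :=
  ContMDiffOn 𝓘(ℝ, ℂ) (𝓘(ℝ, ℝ).prod (𝓡 m)) ∞ v D ∧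
  ∀ z ∈ D, ∃ W ∈ 𝓝[D] z,
    MapsTo v W (extChartAt (𝓘(ℝ, ℝ).prod (𝓡 m)) (v z)).source ∧
    (∀ᶠ k in atTop, MapsTo (f k) W (extChartAt (𝓘(ℝ, ℝ).prod (𝓡 m)) (v z)).source) ∧
    ∀ j : ℕ, TendstoUniformlyOn
      (fun k => iteratedFDerivWithin ℝ j (extChartAt (𝓘(ℝ, ℝ).prod (𝓡 m)) (v z) ∘ f k) D)
      (iteratedFDerivWithin ℝ j (extChartAt (𝓘(ℝ, ℝ).prod (𝓡 m)) (v z) ∘ v) D) atTop W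

end Maps

/-! ### Symplectic manifolds with concave ends -/

section Ends

variable {n : ℕ} {X : Type*} [TopologicalSpace X]
  [ChartedSpace (EuclideanSpace ℝ (Fin (2 * n + 2))) X]

/-- A concave end of the `(2n+2)`-dimensional symplectic manifold `(X, Om)`: a part of `X`
symplectically isomorphic to `((-∞, R) × N, d(e^α lam))`, `α` being the coordinate of `(-∞, R)`.
The subsets `(-∞, d] × N`, `d < R`, are closed in `X`, i.e. `α → -∞` leads to infinity in `X`. -/
structure ConcaveEnd (Om : DiffForm (2 * n + 2) X 2) {N : Type*} [TopologicalSpace N]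
    [ChartedSpace (EuclideanSpace ℝ (Fin (2 * n + 1))) N]
    (lam : DiffForm (2 * n + 1) N 1) (R : ℝ) where
  /-- the coordinates `(α, x)` on the end -/
  coord : PartialDiffeomorph (𝓡 (2 * n + 2)) (𝓘(ℝ, ℝ).prod (𝓡 (2 * n + 1))) X (ℝ × N) ∞
  target_eq : coord.target = Iio R ×ˢ univ
  closed : ∀ d < R, IsClosed {p | p ∈ coord.source ∧ (coord p).1 ≤ d}
  symplectic : ∀ p ∈ coord.source, ∀ v w : TangentSpace (𝓡 (2 * n + 2)) p,
    Om p ![v, w] = dScaled Real.exp lam (coord p)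
      (mfderiv (𝓡 (2 * n + 2)) 𝓘(ℝ, ℝ) (fun y => (coord y).1) p v,
        mfderiv (𝓡 (2 * n + 2)) (𝓡 (2 * n + 1)) (fun y => (coord y).2) p v)
      (mfderiv (𝓡 (2 * n + 2)) 𝓘(ℝ, ℝ) (fun y => (coord y).1) p w,
        mfderiv (𝓡 (2 * n + 2)) (𝓡 (2 * n + 1)) (fun y => (coord y).2) p w)

/-- On the concave end, `J` is the almost complex structure
`a ∂_α + b Reeb + k ↦ -b ∂_α + a Reeb + I k`, `k ∈ ξ`, of some complex structure `I` on `ξ`. -/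
def ConcaveEnd.IsCylindrical {Om : DiffForm (2 * n + 2) X 2} {N : Type*} [TopologicalSpace N]
    [ChartedSpace (EuclideanSpace ℝ (Fin (2 * n + 1))) N]
    {lam : DiffForm (2 * n + 1) N 1} {R : ℝ} (e : ConcaveEnd Om lam R)
    (J : ∀ p : X, TangentSpace (𝓡 (2 * n + 2)) p →L[ℝ] TangentSpace (𝓡 (2 * n + 2)) p) : Prop :=
  ∃ I : ∀ x : N, TangentSpace (𝓡 (2 * n + 1)) x →L[ℝ] TangentSpace (𝓡 (2 * n + 1)) x,
    IsContactComplexStructure lam I ∧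
    ∀ p ∈ e.coord.source, ∀ r k : TangentSpace (𝓡 (2 * n + 1)) (e.coord p).2,
      IsReebVector lam (e.coord p).2 r → lam (e.coord p).2 ![k] = 0 →
      ∀ (a b : ℝ) (v : TangentSpace (𝓡 (2 * n + 2)) p),
        mfderiv (𝓡 (2 * n + 2)) 𝓘(ℝ, ℝ) (fun y => (e.coord y).1) p v = a →
        mfderiv (𝓡 (2 * n + 2)) (𝓡 (2 * n + 1)) (fun y => (e.coord y).2) p v = b • r + k →
        mfderiv (𝓡 (2 * n + 2)) 𝓘(ℝ, ℝ) (fun y => (e.coord y).1) p (J p v) = -b ∧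
        mfderiv (𝓡 (2 * n + 2)) (𝓡 (2 * n + 1)) (fun y => (e.coord y).2) p (J p v) =
          a • r + I (e.coord p).2 k

/-- A symplectic manifold `X` of dimension `2n+2` with concave ends `(-∞, R a) × M a`, two
Lagrangian submanifolds `L 0` and `L 1` which intersect transversally and are cylindrical over
Legendrian submanifolds `Leg a 0`, `Leg a 1` on the ends, and a time-dependent compatible almost
complex structure which is cylindrical on the ends. -/
structure LagrangianPair (n : ℕ) (X : Type*) [TopologicalSpace X]
    [ChartedSpace (EuclideanSpace ℝ (Fin (2 * n + 2))) X] [IsManifold (𝓡 (2 * n + 2)) ∞ X]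
    {A : Type*} (M : A → Type*) [∀ a, TopologicalSpace (M a)]
    [∀ a, ChartedSpace (EuclideanSpace ℝ (Fin (2 * n + 1))) (M a)] where
  Om : DiffForm (2 * n + 2) X 2
  symplectic : IsSymplecticForm Om
  lam : ∀ a, DiffForm (2 * n + 1) (M a) 1
  contact : ∀ a, IsContactForm (lam a)
  R : A → ℝ
  concaveEnd : ∀ a, ConcaveEnd Om (lam a) (R a)
  disjoint : ∀ a b, a ≠ b →
    Disjoint (concaveEnd a).coord.source (concaveEnd b).coord.source
  L : Fin 2 → Set X
  lagrangian : ∀ i, IsLagrangian (n + 1) Om (L i)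
  transverse : ∀ p ∈ L 0 ∩ L 1,
    Submodule.span ℝ (tangentVectors (2 * n + 2) (L 0) p) ⊔
      Submodule.span ℝ (tangentVectors (2 * n + 2) (L 1) p) = ⊤
  Leg : ∀ a, Fin 2 → Set (M a)
  legendrian : ∀ a i, IsLegendrian n (lam a) (Leg a i)
  cone : ∀ a i, ∀ p ∈ (concaveEnd a).coord.source,
    p ∈ L i ↔ ((concaveEnd a).coord p).2 ∈ Leg a i
  J : ℝ → ∀ p : X, TangentSpace (𝓡 (2 * n + 2)) p →L[ℝ] TangentSpace (𝓡 (2 * n + 2)) p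
  compatible : IsCompatibleFamily Om J
  cylindrical : ∀ a, ∀ t ∈ Icc (0 : ℝ) 1, (concaveEnd a).IsCylindrical (J t)

end Ends

/-! ### Strips and their limits in a concave end -/

namespace LagrangianPair

variable {n : ℕ} {X : Type*} [TopologicalSpace X]
  [ChartedSpace (EuclideanSpace ℝ (Fin (2 * n + 2))) X] [IsManifold (𝓡 (2 * n + 2)) ∞ X]
  {A : Type*} {M : A → Type*} [∀ a, TopologicalSpace (M a)]
  [∀ a, ChartedSpace (EuclideanSpace ℝ (Fin (2 * n + 1))) (M a)]

/-- Pseudo-holomorphic strips with Lagrangian boundary conditions: smooth maps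
`u : ℝ × [0,1] → X` with `∂u/∂τ + J_t(u) ∂u/∂t = 0`, `u(ℝ,0) ⊆ L 0` and `u(ℝ,1) ⊆ L 1`. -/
structure IsStrip (P : LagrangianPair n X M) (u : ℂ → X) : Prop where
  smooth : ContMDiffOn 𝓘(ℝ, ℂ) (𝓡 (2 * n + 2)) ∞ u strip
  holomorphic : ∀ z ∈ strip, partialD (2 * n + 2) strip u z 1 +
    P.J z.im (u z) (partialD (2 * n + 2) strip u z Complex.I) = 0
  lower : ∀ z : ℂ, z.im = 0 → u z ∈ P.L 0
  upper : ∀ z : ℂ, z.im = 1 → u z ∈ P.L 1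

/-- `u` tends to an intersection point of `L 0` and `L 1`, uniformly in `t ∈ [0,1]`, as `τ` tends
to `-∞` (for `l = atBot`) or `∞` (for `l = atTop`). -/
def TendsToPoint (P : LagrangianPair n X M) (l : Filter ℝ) (u : ℂ → X) : Prop :=
  ∃ p ∈ P.L 0 ∩ P.L 1, Tendsto u (comap Complex.re l ⊓ 𝓟 strip) (𝓝 p)

/-- As `τ` tends to `±∞` along `l`, `u = (α, x)` runs to `α = -∞` in the concave end `a`, and
`x(τ, t)` tends to `c(t)`, both uniformly in `t ∈ [0,1]`. -/
def TendsToCurve (P : LagrangianPair n X M) (l : Filter ℝ) (u : ℂ → X) (a : A)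
    (c : ℝ → M a) : Prop :=
  (∀ᶠ z in comap Complex.re l ⊓ 𝓟 strip, u z ∈ (P.concaveEnd a).coord.source) ∧
  Tendsto (fun z => ((P.concaveEnd a).coord (u z)).1) (comap Complex.re l ⊓ 𝓟 strip) atBot ∧
  ∀ t ∈ Icc (0 : ℝ) 1, Tendsto (fun z => ((P.concaveEnd a).coord (u z)).2)
    (comap Complex.re l ⊓ comap Complex.im (𝓝[Icc 0 1] t)) (𝓝 (c t))

/-- As `τ → -∞`, `u` is asymptotic to a Reeb chord from `Leg a 0` to `Leg a 1`. -/
def NegativeChord (P : LagrangianPair n X M) (u : ℂ → X) : Prop :=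
  ∃ (a : A) (T : ℝ) (γ : ℝ → M a), IsReebChord (P.lam a) (P.Leg a 0) (P.Leg a 1) T γ ∧
    P.TendsToCurve atBot u a (fun t => γ (T * t))

/-- As `τ → ∞`, `u` is asymptotic to a Reeb chord from `Leg a 1` to `Leg a 0`, reversed. -/
def PositiveChord (P : LagrangianPair n X M) (u : ℂ → X) : Prop :=
  ∃ (a : A) (T : ℝ) (γ : ℝ → M a), IsReebChord (P.lam a) (P.Leg a 1) (P.Leg a 0) T γ ∧
    P.TendsToCurve atTop u a (fun t => γ (T * (1 - t)))

/-- Type (I): both ends of the strip tend to intersection points. -/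
def IsTypeI (P : LagrangianPair n X M) (u : ℂ → X) : Prop :=
  P.TendsToPoint atBot u ∧ P.TendsToPoint atTop u

/-- Type (II): a Reeb chord at `τ = -∞`, an intersection point at `τ = ∞`. -/
def IsTypeII (P : LagrangianPair n X M) (u : ℂ → X) : Prop :=
  P.NegativeChord u ∧ P.TendsToPoint atTop u

/-- Type (II'): an intersection point at `τ = -∞`, a Reeb chord at `τ = ∞`. -/
def IsTypeII' (P : LagrangianPair n X M) (u : ℂ → X) : Prop :=
  P.TendsToPoint atBot u ∧ P.PositiveChord u

/-- Type (III): Reeb chords at `τ = -∞` and at `τ = ∞`. -/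
def IsTypeIII (P : LagrangianPair n X M) (u : ℂ → X) : Prop :=
  P.NegativeChord u ∧ P.PositiveChord u

/-- The coordinates of `u ∘ φ` on the concave end `a`, translated in the direction of `α` so that
the point `u q` gets the coordinate `α = 0`. -/
def translated (P : LagrangianPair n X M) (a : A) (u : ℂ → X) (q : ℂ) (φ : ℂ → ℂ) (z : ℂ) :
    ℝ × M a :=
  (((P.concaveEnd a).coord (u (φ z))).1 - ((P.concaveEnd a).coord (u q)).1,
    ((P.concaveEnd a).coord (u (φ z))).2)

/-- The discs of radius `δ k` about the points `q k` of the strip are mapped by `u k` into the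
concave end `a`, and `u k (q k)` runs to `α = -∞`. -/
structure DiscsInEnd (P : LagrangianPair n X M) (a : A) (u : ℕ → ℂ → X) (q : ℕ → ℂ)
    (δ : ℕ → ℝ) : Prop where
  mem_strip : ∀ k, q k ∈ strip
  radius_pos : ∀ k, 0 < δ k
  mem_end : ∀ k, ∀ z ∈ strip, dist z (q k) < δ k → u k z ∈ (P.concaveEnd a).coord.source
  tendsto : Tendsto (fun k => ((P.concaveEnd a).coord (u k (q k))).1) atTop atBot

/-- The map `v`, defined on `D`, is a `C^∞_loc`-limit in the concave end `a` of rescalings or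
translations of the strips `u k`. The scaling factors `m k` are arbitrary; the norms of the
differentials of `u k` at `q k` are a possible choice. -/
inductive IsLimitOfSequence (P : LagrangianPair n X M) (a : A) (u : ℕ → ℂ → X) (v : ℂ → ℝ × M a) :
    Set ℂ → Prop
  /-- a limit on the plane of rescalings about interior points -/
  | plane (q : ℕ → ℂ) (δ m : ℕ → ℝ) (hq : P.DiscsInEnd a u q δ)
      (interior : ∀ k z, dist z (q k) < δ k → z.im ∈ Ioo (0 : ℝ) 1)
      (hδ : Tendsto δ atTop (𝓝 0)) (hm : ∀ k, 0 < m k)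
      (hδm : Tendsto (fun k => δ k * m k) atTop atTop)
      (lim : ConvergesSmoothly (2 * n + 1) univ
        (fun k => P.translated a (u k) (q k) fun z => q k + z / (m k : ℂ)) v) :
      IsLimitOfSequence P a u v univ
  /-- a limit on the half plane of rescalings near the boundary line `t = 0` -/
  | lower (q : ℕ → ℂ) (δ m : ℕ → ℝ) (hq : P.DiscsInEnd a u q δ)
      (hδ : Tendsto δ atTop (𝓝 0)) (hm : ∀ k, 0 < m k)
      (hδm : Tendsto (fun k => δ k * m k) atTop atTop)
      (near : ∃ B : ℝ, ∀ k, (q k).im * m k ≤ B)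
      (lim : ConvergesSmoothly (2 * n + 1) halfPlane
        (fun k => P.translated a (u k) (q k) fun z => ((q k).re : ℂ) + z / (m k : ℂ)) v) :
      IsLimitOfSequence P a u v halfPlane
  /-- a limit on the half plane of rescalings near the boundary line `t = 1` -/
  | upper (q : ℕ → ℂ) (δ m : ℕ → ℝ) (hq : P.DiscsInEnd a u q δ)
      (hδ : Tendsto δ atTop (𝓝 0)) (hm : ∀ k, 0 < m k)
      (hδm : Tendsto (fun k => δ k * m k) atTop atTop)
      (near : ∃ B : ℝ, ∀ k, (1 - (q k).im) * m k ≤ B)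
      (lim : ConvergesSmoothly (2 * n + 1) halfPlane
        (fun k => P.translated a (u k) (q k)
          fun z => ((q k).re : ℂ) + Complex.I - z / (m k : ℂ)) v) :
      IsLimitOfSequence P a u v halfPlane
  /-- a limit on the strip of translations -/
  | translation (q : ℕ → ℂ) (δ : ℕ → ℝ) (hq : P.DiscsInEnd a u q δ)
      (hδ : Tendsto δ atTop atTop)
      (lim : ConvergesSmoothly (2 * n + 1) strip
        (fun k => P.translated a (u k) (q k) fun z => z + ((q k).re : ℂ)) v) :
      IsLimitOfSequence P a u v strip

/-- The map `v`, defined on `D`, is a limit as above of a subsequence of the strips `u i`. -/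
def IsLimit (P : LagrangianPair n X M) (a : A) (u : ℕ → ℂ → X) (D : Set ℂ)
    (v : ℂ → ℝ × M a) : Prop :=
  ∃ s : ℕ → ℕ, StrictMono s ∧ P.IsLimitOfSequence a (fun k => u (s k)) v D

end LagrangianPair

end ConcaveEnds

end

noncomputable section

/-! On an end write a strip as `(g, x)` with `g = α ∘ u`. The components of the Cauchy-Riemann
equation along `∂_α` and the Reeb field are `lam(x_τ) = -g_t` and `lam(x_t) = g_τ`. Hence `x^* lam =
-g_t dτ + g_τ dt`, so `d lam(x_τ, x_t) = Δg`, and positivity of `d lam(·, I·)` on `ξ` gives `Δg ≥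
0`. For every profile `f` the density of `d(f lam)` along the strip is therefore `f'(g)|∇g|² +
f(g)Δg = Δ(F ∘ g)` with `F' = f`; it is non-negative as soon as `f ≥ 0` and `f' ≥ 0`. The case `f =
exp` is the symplectic density.

Given a cutoff `φ` and levels `d' < d < R`, let `f` be monotone, equal to `e^{d'} φ(s - c)` on `[b,
d']`, to `e^s` for `s ≥ d`, and to zero for `s ≤ b - 1`. The primitive `θ` of `f - exp` vanishing on
`[d, ∞)` is bounded, and `w = θ(α)` extends by zero to a smooth function on `X`. Along the strip,
adding `Δw` to the symplectic density replaces `exp` by `f` inside the end. Legendrian boundary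
conditions give `g_t = 0` on both boundary lines, so `w` satisfies a Neumann condition; two
integrations by parts against a weight of width `r` leave an error `O(sup |w| / r)`. Thus the change
of profile costs no energy (`lintegral_openStrip_le`), and the `φ`-energy of the part of the strip
where `b < α < d'` is at most `e^{-d'}` times the symplectic energy
(`IsStrip.lintegral_density_le`).

This estimate is uniform in `b` and in the shift `c`, and it is invariant under `z ↦ p + c z`. Since
`α` at the rescaling centres tends to `-∞`, every point of the limit domain away from its boundary
is eventually mapped below any fixed level. Fatou's lemma carries the bound to the limit
(`hoferEnergy_le_of_convergesSmoothly`), and `d'` then tends to `R`. -/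

namespace ConcaveEnds

/-! ### Second order calculus on the plane -/

/-- The Laplacian `g_ττ + g_tt` of a function on `ℂ`. -/
def lap (g : ℂ → ℝ) (z : ℂ) : ℝ :=
  fderiv ℝ (fderiv ℝ g) z 1 1 + fderiv ℝ (fderiv ℝ g) z Complex.I Complex.I

/-- The squared norm of the gradient of a function on `ℂ`. -/
def gradSq (g : ℂ → ℝ) (z : ℂ) : ℝ :=
  fderiv ℝ g z 1 ^ 2 + fderiv ℝ g z Complex.I ^ 2

/-- The expression `f'(g) |∇g|² + f(g) Δg`. -/
def density (f : ℝ → ℝ) (g : ℂ → ℝ) (z : ℂ) : ℝ :=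
  deriv f (g z) * gradSq g z + f (g z) * lap g z

theorem gradSq_nonneg (g : ℂ → ℝ) (z : ℂ) : 0 ≤ gradSq g z := by
  unfold gradSq; positivity

theorem differentiableAt_fderiv {g : ℂ → ℝ} {z : ℂ} (hg : ContDiffAt ℝ 2 g z) :
    DifferentiableAt ℝ (fderiv ℝ g) z :=
  (hg.fderiv_right (m := 1) (by norm_num)).differentiableAt (by norm_num)

/-- The chain rule makes the difference of two densities the Laplacian of a function on the strip,
and it is this Laplacian that gets integrated by parts. -/
theorem lap_comp {F : ℝ → ℝ} (hF : ContDiff ℝ 2 F) {g : ℂ → ℝ} {z : ℂ}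
    (hg : ContDiffAt ℝ 2 g z) : lap (fun y => F (g y)) z = density (deriv F) g z := by
  have h1 : fderiv ℝ (fun y => F (g y)) =ᶠ[𝓝 z] fun y => deriv F (g y) • fderiv ℝ g y := by
    have : ∀ᶠ y in 𝓝 z, ContDiffAt ℝ 2 g y := hg.eventually (by simp)
    filter_upwards [this] with y hy
    exact ((hF.differentiable (by norm_num)).differentiableAt.hasDerivAt.comp_hasFDerivAt y
      (hy.differentiableAt (by norm_num)).hasFDerivAt).fderiv
  have hF' : Differentiable ℝ (deriv F) :=
    (hF.iterate_deriv' 1 1).differentiable (by norm_num)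
  have h2 : HasFDerivAt (fun y => deriv F (g y)) (deriv (deriv F) (g z) • fderiv ℝ g z) z :=
    hF'.differentiableAt.hasDerivAt.comp_hasFDerivAt z
      (hg.differentiableAt (by norm_num)).hasFDerivAt
  have h3 := h2.fun_smul (differentiableAt_fderiv hg).hasFDerivAt
  unfold density gradSq lap
  rw [h1.fderiv_eq, h3.fderiv]
  simp only [add_apply, smul_apply,
    ContinuousLinearMap.smulRight_apply, smul_eq_mul]
  ring

theorem density_sub {f₁ f₂ : ℝ → ℝ} (h₁ : Differentiable ℝ f₁) (h₂ : Differentiable ℝ f₂)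
    (g : ℂ → ℝ) (z : ℂ) :
    density (fun s => f₁ s - f₂ s) g z = density f₁ g z - density f₂ g z := by
  unfold density
  rw [deriv_fun_sub h₁.differentiableAt h₂.differentiableAt]
  ring

theorem fderiv_comp_affine (g : ℂ → ℝ) (c s : ℝ) (p z : ℂ) :
    fderiv ℝ (fun y => g (p + c • y) - s) z = c • fderiv ℝ g (p + c • z) := by
  rw [fderiv_sub_const]
  have h := fderiv_comp_smul (𝕜 := ℝ) (f := fun y => g (p + y)) (x := z) c
  rw [h, fderiv_comp_add_left]

/-- The factor `c ^ 2` is the Jacobian of `y ↦ p + c • y`, so energies are invariant under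
rescaling. The sign of `c` is free, since rescaling at the upper boundary line uses a negative `c`.
-/
theorem density_comp_affine (φ : ℝ → ℝ) (g : ℂ → ℝ) (c s : ℝ) (p z : ℂ) :
    density φ (fun y => g (p + c • y) - s) z =
      c ^ 2 * density (fun x => φ (x - s)) g (p + c • z) := by
  have h1 : fderiv ℝ (fun y => g (p + c • y) - s) = fun y => c • fderiv ℝ g (p + c • y) :=
    funext fun y => fderiv_comp_affine g c s p y
  have h2 : fderiv ℝ (fun y => c • fderiv ℝ g (p + c • y)) z =
      c • c • fderiv ℝ (fderiv ℝ g) (p + c • z) := by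
    have h := fderiv_comp_smul (𝕜 := ℝ) (f := fun y => fderiv ℝ g (p + y)) (x := z) c
    rw [fderiv_comp_add_left] at h
    rw [← h]
    exact congrFun (fderiv_const_smul_field (f := fun y => fderiv ℝ g (p + c • y)) c) z
  unfold density gradSq lap
  rw [h1, h2, deriv_comp_sub_const]
  simp only [smul_apply, smul_eq_mul]
  ring

theorem ContDiffAt.continuousAt_density {φ : ℝ → ℝ} (hφ : ContDiff ℝ 1 φ) {g : ℂ → ℝ} {z : ℂ}
    (hg : ContDiffAt ℝ 2 g z) : ContinuousAt (density φ g) z := by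
  have h0 : ContinuousAt g z := hg.continuousAt
  have h1 : ContinuousAt (fderiv ℝ g) z := (differentiableAt_fderiv hg).continuousAt
  have h2 : ContinuousAt (fderiv ℝ (fderiv ℝ g)) z :=
    ((hg.fderiv_right (m := 1) (by norm_num)).fderiv_right (m := 0) (by norm_num)).continuousAt
  have h3 : ContinuousAt (fun y => deriv φ (g y)) z :=
    (hφ.continuous_deriv (by norm_num)).continuousAt.comp h0
  have h4 : ContinuousAt (fun y => φ (g y)) z := hφ.continuous.continuousAt.comp h0
  unfold density gradSq lap
  have e1 : ∀ a : ℂ, ContinuousAt (fun y => fderiv ℝ g y a) z := fun a => h1.clm_apply continuousAt_const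
  have e2 : ∀ a : ℂ, ContinuousAt (fun y => fderiv ℝ (fderiv ℝ g) y a a) z := fun a =>
    (h2.clm_apply continuousAt_const).clm_apply continuousAt_const
  exact (h3.mul (((e1 _).pow 2).add ((e1 _).pow 2))).add (h4.mul ((e2 _).add (e2 _)))

/-! ### The strip -/

/-- The open strip `ℝ × (0,1)`. -/
def openStrip : Set ℂ := {z | z.im ∈ Ioo (0 : ℝ) 1}

theorem isOpen_openStrip : IsOpen openStrip := isOpen_Ioo.preimage Complex.continuous_im

theorem openStrip_subset_strip : openStrip ⊆ strip := fun _ hz => Ioo_subset_Icc_self hz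

theorem strip_mem_nhds {z : ℂ} (hz : z ∈ openStrip) : strip ∈ 𝓝 z :=
  mem_of_superset (isOpen_openStrip.mem_nhds hz) openStrip_subset_strip

theorem uniqueDiffOn_strip : UniqueDiffOn ℝ strip := by
  apply uniqueDiffOn_convex
  · exact (convex_Icc (0 : ℝ) 1).linear_preimage Complex.imLm
  · refine ⟨⟨0, 1 / 2⟩, mem_interior_iff_mem_nhds.2 (strip_mem_nhds ?_)⟩
    constructor <;> norm_num

/-! ### Integrals of Laplacians over the strip -/

/-- The second derivative in the direction `ζ` of a function on the strip. -/
def secondWithin (w : ℂ → ℝ) (z ζ : ℂ) : ℝ :=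
  fderivWithin ℝ (fun y => fderivWithin ℝ w strip y ζ) strip z ζ

theorem ContDiffOn.fderivWithin_strip_apply {w : ℂ → ℝ} (hw : ContDiffOn ℝ ∞ w strip) (ζ : ℂ) :
    ContDiffOn ℝ ∞ (fun y => fderivWithin ℝ w strip y ζ) strip :=
  (hw.fderivWithin uniqueDiffOn_strip (by simp)).clm_apply contDiffOn_const

/-- The second derivatives within the strip are continuous up to the boundary lines, hence
integrable on closed rectangles; `lap` is controlled at interior points only. -/
theorem lap_eq_secondWithin {w : ℂ → ℝ} (hw : ContDiffOn ℝ ∞ w strip) {z : ℂ}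
    (hz : z ∈ openStrip) :
    lap w z = secondWithin w z 1 + secondWithin w z Complex.I := by
  have hd : DifferentiableAt ℝ (fderiv ℝ w) z :=
    differentiableAt_fderiv ((hw.contDiffAt (strip_mem_nhds hz)).of_le (by norm_cast))
  have key : ∀ ζ : ℂ, secondWithin w z ζ = fderiv ℝ (fderiv ℝ w) z ζ ζ := by
    intro ζ
    unfold secondWithin
    rw [fderivWithin_of_mem_nhds (strip_mem_nhds hz)]
    have h : (fun y => fderivWithin ℝ w strip y ζ) =ᶠ[𝓝 z] fun y => fderiv ℝ w y ζ := by
      filter_upwards [isOpen_openStrip.mem_nhds hz] with y hy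
      rw [fderivWithin_of_mem_nhds (strip_mem_nhds hy)]
    rw [h.fderiv_eq, fderiv_clm_apply hd (by fun_prop)]
    simp
  rw [key, key, lap]

/-- The map `(x, y) ↦ x + iy`. -/
def toComplex : ℝ × ℝ →L[ℝ] ℂ := Complex.equivRealProdCLM.symm.toContinuousLinearMap

@[simp] theorem toComplex_re (p : ℝ × ℝ) : (toComplex p).re = p.1 := rfl
@[simp] theorem toComplex_im (p : ℝ × ℝ) : (toComplex p).im = p.2 := rfl

theorem toComplex_one_zero : toComplex (1, 0) = 1 := by apply Complex.ext <;> simp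
theorem toComplex_zero_one : toComplex (0, 1) = Complex.I := by apply Complex.ext <;> simp

theorem setLIntegral_toComplex (e : ℂ → ℝ≥0∞) (S : Set ℂ) :
    ∫⁻ p in toComplex ⁻¹' S, e (toComplex p) = ∫⁻ z in S, e z :=
  (Complex.volume_preserving_equiv_real_prod.symm).setLIntegral_comp_preimage_emb
    Complex.measurableEquivRealProd.symm.measurableEmbedding e S

/-- The weight `(1 - (x/r)²)²`, which vanishes to second order at `x = ±r`. -/
def weight (r x : ℝ) : ℝ := (1 - (x / r) ^ 2) ^ 2

/-- The first derivative of `weight r`. -/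
def weightDeriv (r x : ℝ) : ℝ := -4 * (x / r) * (1 - (x / r) ^ 2) / r

/-- The second derivative of `weight r`. -/
def weightDeriv₂ (r x : ℝ) : ℝ := (-4 + 12 * (x / r) ^ 2) / r ^ 2

theorem hasDerivAt_weight (r x : ℝ) : HasDerivAt (weight r) (weightDeriv r x) x := by
  have h := ((((hasDerivAt_id x).div_const r).pow 2).const_sub 1).pow 2
  refine h.congr_deriv ?_
  simp [weightDeriv]; ring

theorem hasDerivAt_weightDeriv (r x : ℝ) :
    HasDerivAt (weightDeriv r) (weightDeriv₂ r x) x := by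
  have h0 := (hasDerivAt_id x).div_const r
  have h := ((h0.const_mul (-4)).mul ((h0.pow 2).const_sub 1)).div_const r
  refine h.congr_deriv ?_
  simp [weightDeriv₂]; ring

theorem rectangle_subset_preimage_strip (r : ℝ) :
    Icc ((-r, 0) : ℝ × ℝ) (r, 1) ⊆ toComplex ⁻¹' strip := fun _ hp => ⟨hp.1.2, hp.2.2⟩

theorem abs_sq_div_le_one {r x : ℝ} (hx : x ∈ Icc (-r) r) : (x / r) ^ 2 ≤ 1 := by
  rw [div_pow]
  exact div_le_one_of_le₀ (by nlinarith [hx.1, hx.2]) (sq_nonneg _)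

theorem integrableOn_weight_mul {w : ℂ → ℝ} (hw : ContDiffOn ℝ ∞ w strip) (r : ℝ) :
    IntegrableOn (fun p : ℝ × ℝ => weight r p.1 *
      (secondWithin w (toComplex p) 1 + secondWithin w (toComplex p) Complex.I))
      (Icc (-r, 0) (r, 1)) := by
  apply ContinuousOn.integrableOn_compact isCompact_Icc
  have hs := rectangle_subset_preimage_strip r
  have h1 : ∀ ζ, ContinuousOn (fun z => secondWithin w z ζ) strip := fun ζ =>
    (ContDiffOn.fderivWithin_strip_apply
      (ContDiffOn.fderivWithin_strip_apply hw ζ) ζ).continuousOn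
  have h2 : ∀ ζ, ContinuousOn (fun p => secondWithin w (toComplex p) ζ)
      (Icc ((-r, 0) : ℝ × ℝ) (r, 1)) := fun ζ =>
    (h1 ζ).comp toComplex.continuous.continuousOn hs
  have h3 : Continuous fun p : ℝ × ℝ => weight r p.1 := by
    unfold weight; fun_prop
  exact h3.continuousOn.mul ((h2 _).add (h2 _))

/-- With `ρ = weight r`, the divergence theorem for the field `(ρ w_τ - ρ' w, ρ w_t)` gives `∫ ρ Δw
= ∫ ρ'' w`: on the vertical sides `ρ` and `ρ'` vanish, on the horizontal sides `w_t` does. Now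
`|ρ''| ≤ 8 / r²` and the rectangle has area `2r`, whence `16 B / r`. -/
theorem integral_weight_mul_le {w : ℂ → ℝ} (hw : ContDiffOn ℝ ∞ w strip) {B : ℝ}
    (hB : ∀ z ∈ strip, |w z| ≤ B)
    (h0 : ∀ z : ℂ, z.im = 0 ∨ z.im = 1 → fderivWithin ℝ w strip z Complex.I = 0)
    {r : ℝ} (hr : 0 < r) :
    ∫ p in Icc ((-r, 0) : ℝ × ℝ) (r, 1), weight r p.1 *
      (secondWithin w (toComplex p) 1 + secondWithin w (toComplex p) Complex.I) ≤ 16 * B / r := by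
  set Q := Icc ((-r, 0) : ℝ × ℝ) (r, 1) with hQ
  have hs : Q ⊆ toComplex ⁻¹' strip := rectangle_subset_preimage_strip r
  have hd : ∀ ζ, ContDiffOn ℝ ∞ (fun y => fderivWithin ℝ w strip y ζ) strip :=
    ContDiffOn.fderivWithin_strip_apply hw
  have cw : ContinuousOn (fun p => w (toComplex p)) Q :=
    hw.continuousOn.comp toComplex.continuous.continuousOn hs
  have cd : ∀ ζ, ContinuousOn (fun p => fderivWithin ℝ w strip (toComplex p) ζ) Q := fun ζ =>
    (hd ζ).continuousOn.comp toComplex.continuous.continuousOn hs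
  have c0 : Continuous fun p : ℝ × ℝ => weight r p.1 := by unfold weight; fun_prop
  have c1 : Continuous fun p : ℝ × ℝ => weightDeriv r p.1 := by unfold weightDeriv; fun_prop
  have c2 : Continuous fun p : ℝ × ℝ => weightDeriv₂ r p.1 := by unfold weightDeriv₂; fun_prop
  have iw : IntegrableOn (fun p : ℝ × ℝ => weightDeriv₂ r p.1 * w (toComplex p)) Q :=
    (c2.continuousOn.mul cw).integrableOn_compact isCompact_Icc
  have il := integrableOn_weight_mul hw r
  have hfst : ∀ p : ℝ × ℝ, HasFDerivAt (fun q : ℝ × ℝ => q.1)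
      (ContinuousLinearMap.fst ℝ ℝ ℝ) p := fun p => hasFDerivAt_fst
  have hw0 : ∀ p : ℝ × ℝ, HasFDerivAt (fun q : ℝ × ℝ => weight r q.1)
      (weightDeriv r p.1 • ContinuousLinearMap.fst ℝ ℝ ℝ) p := fun p =>
    (hasDerivAt_weight r p.1).comp_hasFDerivAt p (hfst p)
  have hw1 : ∀ p : ℝ × ℝ, HasFDerivAt (fun q : ℝ × ℝ => weightDeriv r q.1)
      (weightDeriv₂ r p.1 • ContinuousLinearMap.fst ℝ ℝ ℝ) p := fun p =>
    (hasDerivAt_weightDeriv r p.1).comp_hasFDerivAt p (hfst p)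
  have hpull : ∀ {k : ℂ → ℝ}, ContDiffOn ℝ ∞ k strip →
      ∀ p ∈ Ioo (-r) r ×ˢ Ioo (0 : ℝ) 1, HasFDerivAt (fun q => k (toComplex q))
        ((fderivWithin ℝ k strip (toComplex p)).comp toComplex) p := by
    intro k hk p hp
    have hp' : toComplex p ∈ openStrip := hp.2
    have h := (hk.differentiableOn (by simp) _ (openStrip_subset_strip hp')).hasFDerivWithinAt
    exact (h.hasFDerivAt (strip_mem_nhds hp')).comp p toComplex.hasFDerivAt
  have hdiv := integral_divergence_prod_Icc_of_hasFDerivAt_of_le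
    (fun p : ℝ × ℝ => weight r p.1 * fderivWithin ℝ w strip (toComplex p) 1 -
      weightDeriv r p.1 * w (toComplex p))
    (fun p : ℝ × ℝ => weight r p.1 * fderivWithin ℝ w strip (toComplex p) Complex.I)
    _ _ (-r, 0) (r, 1) (by constructor <;> simp [hr.le])
    ((c0.continuousOn.mul (cd 1)).sub (c1.continuousOn.mul cw))
    (c0.continuousOn.mul (cd Complex.I))
    (fun p hp => ((hw0 p).mul (hpull (hd 1) p hp)).sub ((hw1 p).mul (hpull hw p hp)))
    (fun p hp => (hw0 p).mul (hpull (hd Complex.I) p hp))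
    (by
      refine (il.sub iw).congr_fun (fun p _ => ?_) measurableSet_Icc
      simp [secondWithin, toComplex_one_zero, toComplex_zero_one]
      ring)
  have hzero : ∫ p in Q, (weight r p.1 * (secondWithin w (toComplex p) 1 +
      secondWithin w (toComplex p) Complex.I) - weightDeriv₂ r p.1 * w (toComplex p)) = 0 := by
    have e1 : ∀ x y : ℝ, y = 0 ∨ y = 1 → fderivWithin ℝ w strip (toComplex (x, y)) Complex.I = 0 :=
      fun x y h => h0 _ h
    have e2 : weight r r = 0 := by simp [weight, hr.ne']
    have e3 : weight r (-r) = 0 := by simp [weight, hr.ne']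
    have e4 : weightDeriv r r = 0 := by simp [weightDeriv, hr.ne']
    have e5 : weightDeriv r (-r) = 0 := by simp [weightDeriv, hr.ne']
    simp only [e1 _ _ (Or.inl rfl), e1 _ _ (Or.inr rfl), e2, e3, e4, e5, mul_zero, zero_mul,
      sub_zero, intervalIntegral.integral_zero, add_zero] at hdiv
    rw [← hdiv]
    refine setIntegral_congr_fun measurableSet_Icc fun p _ => ?_
    simp [secondWithin, toComplex_one_zero, toComplex_zero_one]
    ring
  rw [integral_sub il iw, sub_eq_zero] at hzero
  rw [hzero]
  have hvol : (volume : Measure (ℝ × ℝ)).real Q = 2 * r := by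
    rw [hQ, ← Icc_prod_Icc, Measure.volume_eq_prod, measureReal_prod_prod]
    simp [hr.le]; ring
  have hb : ∀ p ∈ Q, ‖weightDeriv₂ r p.1 * w (toComplex p)‖ ≤ 8 / r ^ 2 * B := by
    intro p hp
    have hx := abs_sq_div_le_one (r := r) (x := p.1) ⟨hp.1.1, hp.2.1⟩
    rw [norm_mul]
    refine mul_le_mul ?_ (hB _ (hs hp)) (norm_nonneg _) (by positivity)
    rw [weightDeriv₂, Real.norm_eq_abs, abs_div, abs_of_pos (by positivity : 0 < r ^ 2)]
    gcongr
    rw [abs_le]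
    constructor <;> nlinarith [sq_nonneg (p.1 / r)]
  have := norm_setIntegral_le_of_norm_le_const (μ := (volume : Measure (ℝ × ℝ)))
    isCompact_Icc.measure_lt_top hb
  rw [hvol] at this
  refine (le_abs_self _).trans (this.trans (le_of_eq ?_))
  field_simp; ring

/-- The inequality `x ≤ y + l` with `l` split into positive and negative parts, arranged without
subtraction so that it can be integrated in `ℝ≥0∞`. -/
theorem ofReal_add_ofReal_neg_le {x y l : ℝ} (hx : 0 ≤ x) (h : x ≤ y + l) :
    ENNReal.ofReal x + ENNReal.ofReal (-l) ≤ ENNReal.ofReal y + ENNReal.ofReal l := by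
  rcases le_total 0 l with hl | hl
  · rw [ENNReal.ofReal_of_nonpos (neg_nonpos.2 hl), add_zero]
    exact (ENNReal.ofReal_le_ofReal h).trans ENNReal.ofReal_add_le
  · rw [ENNReal.ofReal_of_nonpos hl, add_zero, ← ENNReal.ofReal_add hx (neg_nonneg.2 hl)]
    exact ENNReal.ofReal_le_ofReal (by linarith)

/-- The negative part of `l` has finite integral and can be cancelled, even when the integral of `y`
is infinite. Only `l` has to be measurable: on the side of `x`, superadditivity of the lower
integral suffices. -/
theorem lintegral_le_add_of_le_add {α : Type*} [MeasurableSpace α] {μ : Measure α}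
    {x y l : α → ℝ} (hl : Integrable l μ) {ε : ℝ} (hε : ∫ p, l p ∂μ ≤ ε)
    (h : ∀ᵐ p ∂μ, 0 ≤ x p ∧ x p ≤ y p + l p) :
    ∫⁻ p, ENNReal.ofReal (x p) ∂μ ≤ ∫⁻ p, ENNReal.ofReal (y p) ∂μ + ENNReal.ofReal ε := by
  have h1 : ∫⁻ p, ENNReal.ofReal (x p) ∂μ + ∫⁻ p, ENNReal.ofReal (-l p) ∂μ ≤
      ∫⁻ p, ENNReal.ofReal (y p) ∂μ + ∫⁻ p, ENNReal.ofReal (l p) ∂μ := by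
    rw [← lintegral_add_right' _ hl.1.aemeasurable.ennreal_ofReal]
    refine (le_lintegral_add _ _).trans (lintegral_mono_ae ?_)
    filter_upwards [h] with p hp
    exact ofReal_add_ofReal_neg_le hp.1 hp.2
  have hneg : ∫⁻ p, ENNReal.ofReal (-l p) ∂μ ≠ ⊤ := hl.neg.lintegral_lt_top.ne
  have h2 : ∫⁻ p, ENNReal.ofReal (l p) ∂μ ≤
      ENNReal.ofReal ε + ∫⁻ p, ENNReal.ofReal (-l p) ∂μ := by
    have := integral_eq_lintegral_pos_part_sub_lintegral_neg_part hl
    rw [← ENNReal.ofReal_toReal (a := ∫⁻ p, ENNReal.ofReal (l p) ∂μ) hl.lintegral_lt_top.ne,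
      ← ENNReal.ofReal_toReal hneg]
    refine (ENNReal.ofReal_le_ofReal ?_).trans ENNReal.ofReal_add_le
    linarith
  have h3 := h1.trans (add_le_add_right h2 _)
  rw [← add_assoc] at h3
  exact (ENNReal.add_le_add_iff_right hneg).1 h3

theorem lintegral_weight_mul_le {w : ℂ → ℝ} (hw : ContDiffOn ℝ ∞ w strip) {B : ℝ}
    (hB : ∀ z ∈ strip, |w z| ≤ B)
    (h0 : ∀ z : ℂ, z.im = 0 ∨ z.im = 1 → fderivWithin ℝ w strip z Complex.I = 0)
    {g e : ℂ → ℝ} (hg : ∀ z ∈ openStrip, 0 ≤ g z ∧ g z ≤ e z + lap w z) {r : ℝ} (hr : 0 < r) :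
    ∫⁻ p in Icc (-r) r ×ˢ Ioo (0 : ℝ) 1, ENNReal.ofReal (weight r p.1 * g (toComplex p)) ≤
      (∫⁻ z in strip, ENNReal.ofReal (e z)) + ENNReal.ofReal (16 * B / r) := by
  -- The divergence theorem lives on the closed rectangle and the pointwise hypothesis on the open
  -- strip; the two domains differ by a null set.
  have hae : (Icc (-r) r ×ˢ Ioo (0 : ℝ) 1 : Set (ℝ × ℝ)) =ᵐ[volume] Icc ((-r, 0) : ℝ × ℝ) (r, 1) := by
    rw [← Icc_prod_Icc]
    exact Measure.set_prod_ae_eq (ae_eq_refl _) Ioo_ae_eq_Icc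
  have hint := integral_weight_mul_le hw hB h0 hr
  rw [← setIntegral_congr_set hae] at hint
  have hi := (integrableOn_weight_mul hw r).congr_set_ae hae
  refine (lintegral_le_add_of_le_add (y := fun p => weight r p.1 * e (toComplex p)) hi hint
    ?_).trans ?_
  · filter_upwards [ae_restrict_mem (measurableSet_Icc.prod measurableSet_Ioo)] with p hp
    have hz : toComplex p ∈ openStrip := hp.2
    have h1 : 0 ≤ weight r p.1 := sq_nonneg _
    have h2 := hg _ hz
    refine ⟨mul_nonneg h1 h2.1, ?_⟩
    rw [← lap_eq_secondWithin hw hz, ← mul_add]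
    exact mul_le_mul_of_nonneg_left h2.2 h1
  · gcongr
    rw [← setLIntegral_toComplex (fun z => ENNReal.ofReal (e z)) strip]
    refine (setLIntegral_mono_ae' (measurableSet_Icc.prod measurableSet_Ioo)
      (Eventually.of_forall fun p hp => ?_)).trans
      (lintegral_mono_set (fun p hp => Ioo_subset_Icc_self hp.2))
    have hx := abs_sq_div_le_one hp.1
    have h1 : 0 ≤ weight r p.1 := sq_nonneg _
    have h2 : weight r p.1 ≤ 1 := by unfold weight; nlinarith [sq_nonneg (p.1 / r)]
    rcases le_total 0 (e (toComplex p)) with he | he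
    · exact ENNReal.ofReal_le_ofReal (mul_le_of_le_one_left he h2)
    · rw [ENNReal.ofReal_of_nonpos (mul_nonpos_of_nonneg_of_nonpos h1 he)]
      exact zero_le

/-- If `w` is bounded with vanishing normal derivative along the boundary of the strip then adding
`Δw` to a density does not change its integral; here in the form of an inequality. -/
theorem lintegral_openStrip_le {w : ℂ → ℝ} (hw : ContDiffOn ℝ ∞ w strip) {B : ℝ}
    (hB : ∀ z ∈ strip, |w z| ≤ B)
    (h0 : ∀ z : ℂ, z.im = 0 ∨ z.im = 1 → fderivWithin ℝ w strip z Complex.I = 0)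
    {g e : ℂ → ℝ} (hg : ∀ z ∈ openStrip, 0 ≤ g z ∧ g z ≤ e z + lap w z) :
    ∫⁻ z in openStrip, ENNReal.ofReal (g z) ≤ ∫⁻ z in strip, ENNReal.ofReal (e z) := by
  set E := ∫⁻ z in strip, ENNReal.ofReal (e z)
  rw [← setLIntegral_toComplex (fun z => ENNReal.ofReal (g z))]
  have hU : toComplex ⁻¹' openStrip = ⋃ k : ℕ, Icc (-(k : ℝ)) k ×ˢ Ioo (0 : ℝ) 1 := by
    ext p
    simp only [mem_preimage, mem_iUnion, mem_prod, exists_and_right]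
    refine ⟨fun h => ⟨?_, h⟩, fun h => h.2⟩
    obtain ⟨k, hk⟩ := exists_nat_ge |p.1|
    exact ⟨k, abs_le.1 hk⟩
  have hdir : Directed (· ⊆ ·) fun k : ℕ => (Icc (-(k : ℝ)) k ×ˢ Ioo (0 : ℝ) 1 : Set (ℝ × ℝ)) := by
    refine Monotone.directed_le (f := fun k : ℕ => (Icc (-(k : ℝ)) k ×ˢ Ioo (0 : ℝ) 1 : Set (ℝ × ℝ)))
      fun i j hij => prod_mono_left (Icc_subset_Icc ?_ ?_)
    · simpa using hij
    · simpa using hij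
  rw [hU, setLIntegral_iUnion_of_directed _ hdir]
  refine iSup_le fun k => ?_
  set G := ∫⁻ p in Icc (-(k : ℝ)) k ×ˢ Ioo (0 : ℝ) 1, ENNReal.ofReal (g (toComplex p))
  -- On `[-k, k]` the weight of width `r > k` is at least its value at `k`, which tends to `1` as `r
  -- → ∞` while the error `16 B / r` tends to `0`.
  have hbound : ∀ r : ℝ, (k : ℝ) < r →
      ENNReal.ofReal (weight r k) * G ≤ E + ENNReal.ofReal (16 * B / r) := by
    intro r hr
    have hr0 : 0 < r := (Nat.cast_nonneg k).trans_lt hr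
    refine le_trans ?_ (lintegral_weight_mul_le hw hB h0 hg hr0)
    rw [← lintegral_const_mul' _ _ ENNReal.ofReal_ne_top]
    refine le_trans ?_ (lintegral_mono_set (s := Icc (-(k : ℝ)) k ×ˢ Ioo (0 : ℝ) 1)
      (prod_mono_left (Icc_subset_Icc (by linarith) hr.le)))
    refine setLIntegral_mono_ae' (measurableSet_Icc.prod measurableSet_Ioo)
      (Eventually.of_forall fun p hp => ?_)
    have hz : toComplex p ∈ openStrip := hp.2
    rw [← ENNReal.ofReal_mul (show 0 ≤ weight r k from sq_nonneg _)]
    refine ENNReal.ofReal_le_ofReal (mul_le_mul_of_nonneg_right ?_ (hg _ hz).1)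
    have h1 : (p.1 / r) ^ 2 ≤ (k / r) ^ 2 := by
      rw [div_pow, div_pow]
      exact div_le_div_of_nonneg_right (sq_le_sq' hp.1.1 hp.1.2) (sq_nonneg r)
    have h2 : ((k : ℝ) / r) ^ 2 ≤ 1 :=
      abs_sq_div_le_one ⟨by linarith [(Nat.cast_nonneg k : (0 : ℝ) ≤ k)], hr.le⟩
    exact pow_le_pow_left₀ (by linarith) (by linarith) 2
  have l1 : Tendsto (fun r : ℝ => ENNReal.ofReal (weight r k) * G) atTop (𝓝 (ENNReal.ofReal 1 * G)) := by
    refine ENNReal.Tendsto.mul_const ?_ (Or.inl (by simp))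
    refine ENNReal.tendsto_ofReal ?_
    have : Tendsto (fun r : ℝ => (k : ℝ) / r) atTop (𝓝 0) := tendsto_const_nhds.div_atTop tendsto_id
    simpa [weight] using ((this.pow 2).const_sub 1).pow 2
  have l2 : Tendsto (fun r : ℝ => E + ENNReal.ofReal (16 * B / r)) atTop
      (𝓝 (E + ENNReal.ofReal 0)) :=
    tendsto_const_nhds.add (ENNReal.tendsto_ofReal (tendsto_const_nhds.div_atTop tendsto_id))
  have := le_of_tendsto_of_tendsto l1 l2 ((eventually_gt_atTop (k : ℝ)).mono hbound)
  simpa using this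

/-! ### Monotone profiles interpolating between a cutoff and the exponential -/

/-- A smooth monotone profile which vanishes for `s ≤ b - 1`, is `e^d' φ(s - c)` for
`b ≤ s ≤ d'` and `e^s` for `s ≥ d`. -/
def profile (φ : ℝ → ℝ) (b c d' d s : ℝ) : ℝ :=
  Real.smoothTransition (s - (b - 1)) *
    ((1 - Real.smoothTransition ((s - d') / (d - d'))) * (Real.exp d' * φ (s - c)) +
      Real.smoothTransition ((s - d') / (d - d')) * Real.exp s)

section Profile

variable {φ : ℝ → ℝ} {b c d' d : ℝ}

theorem contDiff_profile (hφ : φ ∈ monotoneCutoffs) : ContDiff ℝ ∞ (profile φ b c d' d) := by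
  have h1 := hφ.1
  have h2 : ContDiff ℝ ∞ Real.smoothTransition := Real.smoothTransition.contDiff
  unfold profile
  fun_prop

theorem profile_nonneg (hφ : φ ∈ monotoneCutoffs) (s : ℝ) : 0 ≤ profile φ b c d' d s := by
  have h1 := Real.smoothTransition.nonneg (s - (b - 1))
  have h2 := Real.smoothTransition.nonneg ((s - d') / (d - d'))
  have h3 := Real.smoothTransition.le_one ((s - d') / (d - d'))
  have h4 := (hφ.2.1 (s - c)).1
  have h5 : 0 ≤ 1 - Real.smoothTransition ((s - d') / (d - d')) := by linarith
  unfold profile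
  positivity

theorem monotone_of_mem_monotoneCutoffs (hφ : φ ∈ monotoneCutoffs) : Monotone φ :=
  monotone_of_deriv_nonneg (hφ.1.differentiable (by simp)) hφ.2.2

/-- The inner factor passes from `A = e^{d'} φ(s - c)` to `B = e^s` with a growing share `ρ` of `B`.
Below `d'` only `A` is present; from `d'` on, `A ≤ e^{d'} ≤ B`, so moving weight to `B` can only
increase the value. -/
theorem monotone_profile (hφ : φ ∈ monotoneCutoffs) (hd : d' < d) :
    Monotone (profile φ b c d' d) := by
  have hσ : Monotone Real.smoothTransition := Real.smoothTransition.monotone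
  have hφ' := monotone_of_mem_monotoneCutoffs hφ
  have hin : Monotone fun s =>
      (1 - Real.smoothTransition ((s - d') / (d - d'))) * (Real.exp d' * φ (s - c)) +
      Real.smoothTransition ((s - d') / (d - d')) * Real.exp s := by
    intro x y hxy
    have hA : Real.exp d' * φ (x - c) ≤ Real.exp d' * φ (y - c) :=
      mul_le_mul_of_nonneg_left (hφ' (by linarith)) (Real.exp_pos _).le
    have hB : Real.exp x ≤ Real.exp y := Real.exp_le_exp.2 hxy
    have hρ : Real.smoothTransition ((x - d') / (d - d')) ≤
        Real.smoothTransition ((y - d') / (d - d')) := by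
      apply hσ
      have : 0 < d - d' := by linarith
      gcongr
    have hx0 := Real.smoothTransition.nonneg ((x - d') / (d - d'))
    have hx1 := Real.smoothTransition.le_one ((x - d') / (d - d'))
    rcases le_total y d' with hy | hy
    · have e1 : Real.smoothTransition ((y - d') / (d - d')) = 0 :=
        Real.smoothTransition.zero_of_nonpos (div_nonpos_of_nonpos_of_nonneg (by linarith)
          (by linarith))
      have e2 : Real.smoothTransition ((x - d') / (d - d')) = 0 := le_antisymm (e1 ▸ hρ) hx0
      simpa [e1, e2] using hA
    · have hAB : Real.exp d' * φ (y - c) ≤ Real.exp y :=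
        (mul_le_of_le_one_right (Real.exp_pos _).le (hφ.2.1 _).2).trans (Real.exp_le_exp.2 hy)
      dsimp only
      -- The increment from `x` to `y` equals `(ρ_y - ρ_x)(B_y - A_y) + ρ_x (B_y - B_x) + (1 -
      -- ρ_x)(A_y - A_x)`.
      nlinarith [mul_nonneg (sub_nonneg.2 hρ) (sub_nonneg.2 hAB),
        mul_le_mul_of_nonneg_left hB hx0, mul_le_mul_of_nonneg_left hA (sub_nonneg.2 hx1)]
  refine Monotone.mul (fun x y hxy => hσ (by linarith)) hin
    (fun s => Real.smoothTransition.nonneg _) (fun s => ?_)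
  have h2 := Real.smoothTransition.nonneg ((s - d') / (d - d'))
  have h3 := Real.smoothTransition.le_one ((s - d') / (d - d'))
  have h4 := (hφ.2.1 (s - c)).1
  have h5 : 0 ≤ 1 - Real.smoothTransition ((s - d') / (d - d')) := by linarith
  positivity

theorem deriv_profile_nonneg (hφ : φ ∈ monotoneCutoffs) (hd : d' < d) (s : ℝ) :
    0 ≤ deriv (profile φ b c d' d) s :=
  (monotone_profile hφ hd).deriv_nonneg

theorem profile_eq_zero {s : ℝ} (hs : s ≤ b - 1) : profile φ b c d' d s = 0 := by
  rw [profile, Real.smoothTransition.zero_of_nonpos (by linarith), zero_mul]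

theorem profile_eq_cutoff {s : ℝ} (hd : d' < d) (hb : b ≤ s) (hs : s ≤ d') :
    profile φ b c d' d s = Real.exp d' * φ (s - c) := by
  rw [profile, Real.smoothTransition.one_of_one_le (by linarith),
    Real.smoothTransition.zero_of_nonpos
      (div_nonpos_of_nonpos_of_nonneg (by linarith) (by linarith))]
  ring

theorem profile_eq_exp {s : ℝ} (hd : d' < d) (hb : b ≤ d') (hs : d ≤ s) :
    profile φ b c d' d s = Real.exp s := by
  rw [profile, Real.smoothTransition.one_of_one_le (by linarith),
    Real.smoothTransition.one_of_one_le ((one_le_div (by linarith)).2 (by linarith))]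
  ring

/-- The strict inequalities make the two profiles agree near `g z`, so that their derivatives agree
there as well. -/
theorem density_profile {g : ℂ → ℝ} {z : ℂ} (hφ : φ ∈ monotoneCutoffs) (hd : d' < d)
    (hb : b < g z) (hs : g z < d') :
    density (profile φ b c d' d) g z = Real.exp d' * density (fun s => φ (s - c)) g z := by
  have h : profile φ b c d' d =ᶠ[𝓝 (g z)] fun s => Real.exp d' * φ (s - c) := by
    filter_upwards [Ioo_mem_nhds hb hs] with s hs using profile_eq_cutoff hd hs.1.le hs.2.le
  have h1 := hφ.1
  have hdiff : Differentiable ℝ φ := h1.differentiable (by simp)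
  unfold density
  rw [h.deriv_eq, h.eq_of_nhds, deriv_const_mul _ (by fun_prop)]
  ring

/-- The primitive of `profile - exp` which vanishes on `[d, ∞)`. -/
def profilePrimitive (φ : ℝ → ℝ) (b c d' d s : ℝ) : ℝ :=
  ∫ x in d..s, (profile φ b c d' d x - Real.exp x)

theorem continuous_profile_sub_exp (hφ : φ ∈ monotoneCutoffs) :
    Continuous fun x => profile φ b c d' d x - Real.exp x :=
  (contDiff_profile hφ).continuous.sub Real.continuous_exp

theorem hasDerivAt_profilePrimitive (hφ : φ ∈ monotoneCutoffs) (s : ℝ) :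
    HasDerivAt (profilePrimitive φ b c d' d) (profile φ b c d' d s - Real.exp s) s :=
  intervalIntegral.integral_hasDerivAt_right
    ((continuous_profile_sub_exp hφ).intervalIntegrable _ _)
    (continuous_profile_sub_exp hφ).aestronglyMeasurable.stronglyMeasurableAtFilter
    (continuous_profile_sub_exp hφ).continuousAt

theorem deriv_profilePrimitive (hφ : φ ∈ monotoneCutoffs) :
    deriv (profilePrimitive φ b c d' d) = fun s => profile φ b c d' d s - Real.exp s :=
  funext fun s => (hasDerivAt_profilePrimitive hφ s).deriv

theorem contDiff_profilePrimitive (hφ : φ ∈ monotoneCutoffs) :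
    ContDiff ℝ ∞ (profilePrimitive φ b c d' d) := by
  rw [contDiff_infty_iff_deriv, deriv_profilePrimitive hφ]
  exact ⟨fun s => (hasDerivAt_profilePrimitive hφ s).differentiableAt,
    (contDiff_profile hφ).sub Real.contDiff_exp⟩

theorem profilePrimitive_eq_zero (hd : d' < d) (hb : b ≤ d') {s : ℝ} (hs : d ≤ s) :
    profilePrimitive φ b c d' d s = 0 := by
  rw [profilePrimitive, intervalIntegral.integral_congr (g := fun _ => (0 : ℝ)),
    intervalIntegral.integral_zero]
  intro x hx
  rw [uIcc_of_le hs] at hx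
  simp only [profile_eq_exp hd hb hx.1, sub_self]

/-- This is what the cutoff below `b - 1` is for: there the derivative of the primitive is `-e^s`,
which is integrable at `-∞` and contributes at most `e^(b-1)`. A profile with a positive limit at
`-∞` would have a primitive of linear growth, unbounded on strips with `α → -∞`. -/
theorem exists_abs_profilePrimitive_le (hφ : φ ∈ monotoneCutoffs) (hd : d' < d) (hb : b ≤ d') :
    ∃ B, ∀ s, |profilePrimitive φ b c d' d s| ≤ B := by
  have hc := (contDiff_profilePrimitive (b := b) (c := c) (d' := d') (d := d) hφ).continuous
  obtain ⟨B, hB⟩ := (isCompact_Icc (a := b - 1) (b := d)).exists_bound_of_continuousOn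
    hc.continuousOn
  refine ⟨B + Real.exp (b - 1), fun s => ?_⟩
  have hB0 : 0 ≤ B := (norm_nonneg _).trans (hB d ⟨by linarith, le_rfl⟩)
  have he := Real.exp_pos (b - 1)
  rcases le_total d s with h1 | h1
  · rw [profilePrimitive_eq_zero hd hb h1, abs_zero]; positivity
  rcases le_total (b - 1) s with h2 | h2
  · have := hB s ⟨h2, h1⟩
    rw [Real.norm_eq_abs] at this
    linarith
  have hi : ∀ x y, IntervalIntegrable (fun x => profile φ b c d' d x - Real.exp x) volume x y :=
    fun x y => (continuous_profile_sub_exp hφ).intervalIntegrable x y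
  have h3 : profilePrimitive φ b c d' d s =
      profilePrimitive φ b c d' d (b - 1) + (Real.exp (b - 1) - Real.exp s) := by
    rw [profilePrimitive, ← intervalIntegral.integral_add_adjacent_intervals (hi d (b - 1))
      (hi (b - 1) s), ← profilePrimitive,
      intervalIntegral.integral_congr (a := b - 1) (g := fun x => -Real.exp x),
      intervalIntegral.integral_neg, integral_exp]
    · ring
    · intro x hx
      rw [uIcc_of_ge h2] at hx
      simp [profile_eq_zero hx.2]
  have h4 := hB (b - 1) ⟨le_rfl, by linarith⟩
  rw [Real.norm_eq_abs] at h4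
  have h5 := Real.exp_le_exp.2 h2
  have h6 := Real.exp_pos s
  rw [h3]
  refine (abs_add_le _ _).trans (add_le_add h4 ?_)
  rw [abs_of_nonneg (by linarith)]
  linarith

end Profile

/-! ### Linear algebra of alternating forms of degree one and two -/

section LinearForms

variable {E : Type*} [AddCommGroup E] [Module ℝ E] [TopologicalSpace E]

theorem oneForm_add (l : E [⋀^Fin 1]→L[ℝ] ℝ) (x y : E) : l ![x + y] = l ![x] + l ![y] :=
  l.vecCons_add _ x y

theorem oneForm_smul (l : E [⋀^Fin 1]→L[ℝ] ℝ) (c : ℝ) (x : E) : l ![c • x] = c * l ![x] :=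
  l.vecCons_smul _ c x

theorem oneForm_neg (l : E [⋀^Fin 1]→L[ℝ] ℝ) (x : E) : l ![-x] = -l ![x] := by
  rw [← neg_one_smul ℝ x, oneForm_smul]; ring

theorem twoForm_add_left (o : E [⋀^Fin 2]→L[ℝ] ℝ) (x y z : E) :
    o ![x + y, z] = o ![x, z] + o ![y, z] :=
  o.vecCons_add _ x y

theorem twoForm_smul_left (o : E [⋀^Fin 2]→L[ℝ] ℝ) (c : ℝ) (x z : E) :
    o ![c • x, z] = c * o ![x, z] :=
  o.vecCons_smul _ c x

theorem twoForm_neg_left (o : E [⋀^Fin 2]→L[ℝ] ℝ) (x z : E) : o ![-x, z] = -o ![x, z] := by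
  rw [← neg_one_smul ℝ x, twoForm_smul_left]; ring

theorem twoForm_swap (o : E [⋀^Fin 2]→L[ℝ] ℝ) (x y : E) : o ![x, y] = -o ![y, x] := by
  have h := o.toAlternatingMap.map_swap ![y, x] (i := 0) (j := 1) (by simp)
  have h' : (![y, x] ∘ Equiv.swap 0 1 : Fin 2 → E) = ![x, y] := by
    ext i
    fin_cases i <;> simp
  rw [h'] at h
  exact h

theorem twoForm_self (o : E [⋀^Fin 2]→L[ℝ] ℝ) (x : E) : o ![x, x] = 0 := by
  linarith [twoForm_swap o x x]

theorem twoForm_add_right (o : E [⋀^Fin 2]→L[ℝ] ℝ) (x y z : E) :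
    o ![z, x + y] = o ![z, x] + o ![z, y] := by
  rw [twoForm_swap, twoForm_add_left, twoForm_swap o z x, twoForm_swap o z y]; ring

theorem twoForm_smul_right (o : E [⋀^Fin 2]→L[ℝ] ℝ) (c : ℝ) (x z : E) :
    o ![z, c • x] = c * o ![z, x] := by
  rw [twoForm_swap, twoForm_smul_left, twoForm_swap o z x]; ring

/-- A `1`-form `l` and a `2`-form `o` non-degenerate on `ker l` have a Reeb vector. -/
theorem exists_reeb_of_nondegenerate [FiniteDimensional ℝ E] (l : E [⋀^Fin 1]→L[ℝ] ℝ)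
    (o : E [⋀^Fin 2]→L[ℝ] ℝ) (hl : l ≠ 0)
    (ho : ∀ h : E, l ![h] = 0 → h ≠ 0 → ∃ k : E, l ![k] = 0 ∧ o ![h, k] ≠ 0) :
    ∃ r : E, l ![r] = 1 ∧ ∀ h : E, o ![r, h] = 0 := by
  obtain ⟨r₀, hr₀⟩ : ∃ r : E, l ![r] = 1 := by
    by_contra! hne
    refine hl (ContinuousAlternatingMap.ext fun v => ?_)
    by_contra hv
    have hv' : v = ![v 0] := by ext i; fin_cases i; rfl
    rw [hv'] at hv
    exact hne ((l ![v 0])⁻¹ • v 0) (by rw [oneForm_smul]; exact inv_mul_cancel₀ hv)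
  let ℓ : E →ₗ[ℝ] ℝ :=
    { toFun := fun x => l ![x]
      map_add' := oneForm_add l
      map_smul' := oneForm_smul l }
  let K := LinearMap.ker ℓ
  let T : E →ₗ[ℝ] Module.Dual ℝ K :=
    { toFun := fun x =>
        { toFun := fun k => o ![x, (k : E)]
          map_add' := fun k k' => by simp [twoForm_add_right]
          map_smul' := fun c k => by simp [twoForm_smul_right] }
      map_add' := fun x y => by ext k; simp [twoForm_add_left]
      map_smul' := fun c x => by ext k; simp [twoForm_smul_left] }
  -- Non-degeneracy on `K = ker l` makes `k ↦ o(k, ·)` an isomorphism from `K` to its dual. Hence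
  -- some `k` in `K` has the same pairing with `K` as `r₀`, and `r₀ - k` is the Reeb vector.
  have hinj : Function.Injective (T.comp K.subtype) := by
    rw [injective_iff_map_eq_zero]
    intro h hh
    by_contra hne
    obtain ⟨k, hk, hk'⟩ := ho h h.2 (fun h0 => hne (Subtype.ext h0))
    exact hk' (congrArg (fun f : Module.Dual ℝ K => f ⟨k, hk⟩) hh)
  have hsurj : Function.Surjective (T.comp K.subtype) :=
    (LinearMap.injective_iff_surjective_of_finrank_eq_finrank
      (Subspace.dual_finrank_eq (K := ℝ) (V := K)).symm).1 hinj
  obtain ⟨k, hk⟩ := hsurj (T r₀)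
  have hkl : l ![(k : E)] = 0 := k.2
  have hr : l ![r₀ + -(k : E)] = 1 := by rw [oneForm_add, oneForm_neg, hr₀, hkl]; ring
  have hker : ∀ h : E, l ![h] = 0 → o ![r₀ + -(k : E), h] = 0 := by
    intro h hh
    have := congrArg (fun f : Module.Dual ℝ K => f ⟨h, hh⟩) hk
    change o ![(k : E), h] = o ![r₀, h] at this
    rw [twoForm_add_left, twoForm_neg_left, this]; ring
  refine ⟨r₀ + -(k : E), hr, fun h => ?_⟩
  -- Subtracting the multiple `l(h)` of the new vector moves `h` into `ker l`; the subtracted term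
  -- does not contribute because `o(r, r) = 0`.
  have h1 := hker (h + -(l ![h] • (r₀ + -(k : E))))
    (by rw [oneForm_add, oneForm_neg, oneForm_smul, hr]; ring)
  rw [twoForm_add_right, ← neg_smul, twoForm_smul_right, twoForm_self] at h1
  linarith

end LinearForms

/-! ### Reeb vectors and pullbacks of contact forms to the plane -/

section Forms

variable {m : ℕ} {N : Type*} [TopologicalSpace N] [ChartedSpace (EuclideanSpace ℝ (Fin m)) N]

theorem IsContactForm.exists_isReebVector {lam : DiffForm m N 1} (h : IsContactForm lam) (x : N) :
    ∃ r : TangentSpace (𝓡 m) x, IsReebVector lam x r :=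
  have : FiniteDimensional ℝ (TangentSpace (𝓡 m) x) :=
    inferInstanceAs (FiniteDimensional ℝ (EuclideanSpace ℝ (Fin m)))
  exists_reeb_of_nondegenerate (lam x) (extD lam x)
    (h.ne_zero x) (h.nondegenerate x)

theorem form_congr {k : ℕ} (η : DiffForm m N k) {x y : N} (h : x = y)
    (v w : Fin k → EuclideanSpace ℝ (Fin m)) (hvw : v = w) :
    η x (v : Fin k → TangentSpace (𝓡 m) x) = η y (w : Fin k → TangentSpace (𝓡 m) y) := by
  subst h hvw; rfl

variable [IsManifold (𝓡 m) ∞ N]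

/-- Chain rule for a map read in a chart, and composed with the inverse chart again. -/
theorem mfderiv_symm_fderiv_chart {x : ℂ → N} {x₀ : N} {y : ℂ}
    (hx : MDifferentiableAt 𝓘(ℝ, ℂ) (𝓡 m) x y) (hy : x y ∈ (extChartAt (𝓡 m) x₀).source) (ζ : ℂ) :
    (mfderiv 𝓘(ℝ, EuclideanSpace ℝ (Fin m)) (𝓡 m) (extChartAt (𝓡 m) x₀).symm
      (extChartAt (𝓡 m) x₀ (x y)) (fderiv ℝ (fun y => extChartAt (𝓡 m) x₀ (x y)) y ζ) :
      EuclideanSpace ℝ (Fin m)) = mfderiv 𝓘(ℝ, ℂ) (𝓡 m) x y ζ := by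
  have hy' : x y ∈ (chartAt (EuclideanSpace ℝ (Fin m)) x₀).source := by
    rwa [extChartAt_source] at hy
  have h1 : MDifferentiableAt 𝓘(ℝ, ℂ) 𝓘(ℝ, EuclideanSpace ℝ (Fin m))
      (fun y => extChartAt (𝓡 m) x₀ (x y)) y :=
    (mdifferentiableAt_extChartAt hy').comp y hx
  have h2 : MDifferentiableAt 𝓘(ℝ, EuclideanSpace ℝ (Fin m)) (𝓡 m) (extChartAt (𝓡 m) x₀).symm
      (extChartAt (𝓡 m) x₀ (x y)) :=
    ((contMDiffOn_extChartAt_symm (n := ∞) x₀).contMDiffAt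
      (extChartAt_target_mem_nhds' ((extChartAt (𝓡 m) x₀).map_source hy))).mdifferentiableAt
        (by simp)
  have h3 := mfderiv_comp y h2 h1
  have h4 : ((extChartAt (𝓡 m) x₀).symm ∘ fun y => extChartAt (𝓡 m) x₀ (x y)) =ᶠ[𝓝 y] x := by
    filter_upwards [hx.continuousAt.preimage_mem_nhds (extChartAt_source_mem_nhds' hy)] with z hz
      using (extChartAt (𝓡 m) x₀).left_inv hz
  rw [h4.mfderiv_eq] at h3
  have h5 := congrArg (fun L : ℂ →L[ℝ] EuclideanSpace ℝ (Fin m) => L ζ) h3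
  refine Eq.trans ?_ h5.symm
  rw [← mfderiv_eq_fderiv]
  rfl

theorem formInChart_apply_fderiv {lam : DiffForm m N 1} {x : ℂ → N} {x₀ : N} {y : ℂ}
    (hx : MDifferentiableAt 𝓘(ℝ, ℂ) (𝓡 m) x y) (hy : x y ∈ (extChartAt (𝓡 m) x₀).source) (ζ : ℂ) :
    formInChart lam x₀ (extChartAt (𝓡 m) x₀ (x y))
      ![fderiv ℝ (fun y => extChartAt (𝓡 m) x₀ (x y)) y ζ] =
      lam (x y) ![mfderiv 𝓘(ℝ, ℂ) (𝓡 m) x y ζ] := by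
  refine form_congr lam ((extChartAt (𝓡 m) x₀).left_inv hy) _ _ ?_
  ext i : 1
  fin_cases i
  exact mfderiv_symm_fderiv_chart hx hy ζ

/-- If `lam(x_τ) = -g_t` and `lam(x_t) = g_τ` then `d lam(x_τ, x_t) = Δg`. -/
theorem extD_eq_lap {lam : DiffForm m N 1} (hlam : IsSmoothForm lam) {x : ℂ → N} {z : ℂ}
    (hx : ContMDiffAt 𝓘(ℝ, ℂ) (𝓡 m) ∞ x z) {g : ℂ → ℝ} (hg : ContDiffAt ℝ 2 g z)
    (h1 : ∀ᶠ y in 𝓝 z, lam (x y) ![mfderiv 𝓘(ℝ, ℂ) (𝓡 m) x y (1 : ℂ)] = -fderiv ℝ g y Complex.I)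
    (hI : ∀ᶠ y in 𝓝 z, lam (x y) ![mfderiv 𝓘(ℝ, ℂ) (𝓡 m) x y Complex.I] = fderiv ℝ g y 1) :
    extD lam (x z) ![mfderiv 𝓘(ℝ, ℂ) (𝓡 m) x z (1 : ℂ), mfderiv 𝓘(ℝ, ℂ) (𝓡 m) x z Complex.I] =
      lap g z := by
  set x' : ℂ → EuclideanSpace ℝ (Fin m) := fun y => extChartAt (𝓡 m) (x z) (x y) with hx'
  set η := formInChart lam (x z) with hη
  have hsrc : x z ∈ (extChartAt (𝓡 m) (x z)).source := mem_extChartAt_source (x z)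
  have hcd : ContDiffAt ℝ ∞ x' z :=
    ((contMDiffAt_extChartAt (n := ∞) (x := x z)).comp z hx).contDiffAt
  have hηd : DifferentiableAt ℝ η (x' z) :=
    ((hlam (x z)).contDiffAt (extChartAt_target_mem_nhds (x z))).differentiableAt (by simp)
  have hev : ∀ᶠ y in 𝓝 z, MDifferentiableAt 𝓘(ℝ, ℂ) (𝓡 m) x y ∧
      x y ∈ (extChartAt (𝓡 m) (x z)).source := by
    have e1 : ∀ᶠ y in 𝓝 z, ContMDiffAt 𝓘(ℝ, ℂ) (𝓡 m) 1 x y := by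
      have e0 : ContMDiffAt 𝓘(ℝ, ℂ) (𝓡 m) 1 x z := hx.of_le (by norm_cast)
      exact (contMDiffAt_iff_contMDiffAt_nhds (by norm_cast)).1 e0
    filter_upwards [e1, hx.continuousAt.preimage_mem_nhds (extChartAt_source_mem_nhds (I := 𝓡 m) (x z))]
      with y hy hy'
    exact ⟨hy.mdifferentiableAt (by simp), hy'⟩
  -- This is `x^* lam`, computed in a chart. By hypothesis it equals `-g_t dτ + g_τ dt` near `z`, so
  -- its exterior derivative is `Δg dτ ∧ dt`; the exterior derivative commutes with pullback.
  let σ : ℂ → ℂ [⋀^Fin 1]→L[ℝ] ℝ := fun y => (η (x' y)).compContinuousLinearMap (fderiv ℝ x' y)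
  have hpull : extDeriv σ z = (extDeriv η (x' z)).compContinuousLinearMap (fderiv ℝ x' z) :=
    extDeriv_pullback hηd hcd (by simp; norm_cast)
  have hσd : DifferentiableAt ℝ σ z :=
    (hηd.comp z (hcd.differentiableAt (by simp))).continuousAlternatingMapCompContinuousLinearMap
      ((hcd.fderiv_right (m := 1) (by norm_cast)).differentiableAt (by simp))
  have hσ : ∀ ζ : ℂ, (fun y => σ y ![ζ]) =ᶠ[𝓝 z]
      fun y => lam (x y) ![mfderiv 𝓘(ℝ, ℂ) (𝓡 m) x y ζ] := by
    intro ζ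
    filter_upwards [hev] with y hy
    rw [← formInChart_apply_fderiv hy.1 hy.2 ζ]
    change η (x' y) (fun i => fderiv ℝ x' y (![ζ] i)) = η (x' y) _
    congr 1
    ext i : 1
    fin_cases i; rfl
  have hlhs : extD lam (x z) ![mfderiv 𝓘(ℝ, ℂ) (𝓡 m) x z (1 : ℂ), mfderiv 𝓘(ℝ, ℂ) (𝓡 m) x z Complex.I] =
      extDeriv σ z ![1, Complex.I] := by
    rw [hpull]
    change extDeriv η (x' z) _ = extDeriv η (x' z) _
    congr 1
    have key : ∀ ζ : ℂ, mfderiv (𝓡 m) 𝓘(ℝ, EuclideanSpace ℝ (Fin m)) (extChartAt (𝓡 m) (x z)) (x z)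
        (mfderiv 𝓘(ℝ, ℂ) (𝓡 m) x z ζ) = fderiv ℝ x' z ζ := by
      intro ζ
      have h := mfderiv_comp z (mdifferentiableAt_extChartAt (I := 𝓡 m) (mem_chart_source _ (x z)))
        hev.self_of_nhds.1
      have h' := congrArg (fun L : ℂ →L[ℝ] EuclideanSpace ℝ (Fin m) => L ζ) h
      rw [← mfderiv_eq_fderiv]
      exact h'.symm
    ext i : 1
    fin_cases i
    · exact key 1
    · exact key Complex.I
  rw [hlhs, extDeriv_apply hσd]
  refine (Fin.sum_univ_two _).trans ?_
  have r0 : (0 : Fin 2).removeNth ![(1 : ℂ), Complex.I] = ![Complex.I] := by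
    ext i : 1
    fin_cases i; rfl
  have r1 : (1 : Fin 2).removeNth ![(1 : ℂ), Complex.I] = ![1] := by
    ext i : 1
    fin_cases i; rfl
  have d0 : fderiv ℝ (fun y => σ y ![Complex.I]) z 1 = fderiv ℝ (fderiv ℝ g) z 1 1 := by
    rw [((hσ Complex.I).trans hI).fderiv_eq,
      fderiv_clm_apply (differentiableAt_fderiv hg) (by fun_prop)]
    simp
  have d1 : fderiv ℝ (fun y => σ y ![1]) z Complex.I =
      -fderiv ℝ (fderiv ℝ g) z Complex.I Complex.I := by
    rw [((hσ 1).trans h1).fderiv_eq, fderiv_fun_neg,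
      fderiv_clm_apply (differentiableAt_fderiv hg) (by fun_prop)]
    simp
  rw [r0, r1]
  simp only [Matrix.cons_val_zero, Matrix.cons_val_one, d0, d1, lap]
  simp

end Forms

theorem uniqueMDiffOn_strip : UniqueMDiffOn 𝓘(ℝ, ℂ) strip := uniqueDiffOn_strip.uniqueMDiffOn

/-- Keeping `x` a variable allows the equation `c 0 = x` to be substituted, which removes the
transport in the definition of `tangentVectors`. -/
theorem mem_tangentVectors_of_hasMFDerivAt {m : ℕ} {N : Type*} [TopologicalSpace N]
    [ChartedSpace (EuclideanSpace ℝ (Fin m)) N] {L : Set N} {c : ℝ → N} {x : N} (hx : c 0 = x)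
    (hc : ∀ᶠ s in 𝓝 (0 : ℝ), c s ∈ L) {w : EuclideanSpace ℝ (Fin m)}
    (hd : HasMFDerivAt 𝓘(ℝ, ℝ) (𝓡 m) c 0
      (ContinuousLinearMap.toSpanSingleton ℝ w : ℝ →L[ℝ] EuclideanSpace ℝ (Fin m))) :
    (w : TangentSpace (𝓡 m) x) ∈ tangentVectors m L x := by
  subst hx
  exact ⟨c, rfl, hc, hd⟩

/-! ### Cauchy-Riemann equations and the Neumann condition on an end -/

namespace LagrangianPair

variable {n : ℕ} {X : Type*} [TopologicalSpace X]
  [ChartedSpace (EuclideanSpace ℝ (Fin (2 * n + 2))) X] [IsManifold (𝓡 (2 * n + 2)) ∞ X]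
  {A : Type*} {M : A → Type*} [∀ a, TopologicalSpace (M a)]
  [∀ a, ChartedSpace (EuclideanSpace ℝ (Fin (2 * n + 1))) (M a)]

/-- The part of `X` which is identified with the end `a`. -/
def endSet (P : LagrangianPair n X M) (a : A) : Set X := (P.concaveEnd a).coord.source

/-- The coordinate `α` on the end `a`. -/
def height (P : LagrangianPair n X M) (a : A) (p : X) : ℝ := ((P.concaveEnd a).coord p).1

/-- The coordinate with values in `M a` on the end `a`. -/
def base (P : LagrangianPair n X M) (a : A) (p : X) : M a := ((P.concaveEnd a).coord p).2

/-- The differential of the coordinate `α`. -/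
def dHeight (P : LagrangianPair n X M) (a : A) (p : X) (y : TangentSpace (𝓡 (2 * n + 2)) p) : ℝ :=
  mfderiv (𝓡 (2 * n + 2)) 𝓘(ℝ, ℝ) (P.height a) p y

variable (P : LagrangianPair n X M) (a : A)

theorem isOpen_endSet : IsOpen (P.endSet a) := (P.concaveEnd a).coord.open_source

variable {P a}

theorem contMDiffAt_coord {p : X} (hp : p ∈ P.endSet a) :
    ContMDiffAt (𝓡 (2 * n + 2)) (𝓘(ℝ, ℝ).prod (𝓡 (2 * n + 1))) ∞ (P.concaveEnd a).coord p :=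
  (P.concaveEnd a).coord.contMDiffOn.contMDiffAt ((P.isOpen_endSet a).mem_nhds hp)

theorem contMDiffAt_height {p : X} (hp : p ∈ P.endSet a) :
    ContMDiffAt (𝓡 (2 * n + 2)) 𝓘(ℝ, ℝ) ∞ (P.height a) p :=
  contMDiffAt_fst.comp p (contMDiffAt_coord hp)

theorem contMDiffAt_base {p : X} (hp : p ∈ P.endSet a) :
    ContMDiffAt (𝓡 (2 * n + 2)) (𝓡 (2 * n + 1)) ∞ (P.base a) p :=
  contMDiffAt_snd.comp p (contMDiffAt_coord hp)

/-- The pointwise Cauchy-Riemann equations on a cylindrical end. -/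
theorem cauchyRiemann_of_mem_endSet {t : ℝ} (ht : t ∈ Icc (0 : ℝ) 1) {p : X}
    (hp : p ∈ P.endSet a) {y x : TangentSpace (𝓡 (2 * n + 2)) p} (h : y + P.J t p x = 0) :
    P.lam a (P.base a p) ![mfderiv (𝓡 (2 * n + 2)) (𝓡 (2 * n + 1)) (P.base a) p y] =
      -P.dHeight a p x ∧
    P.lam a (P.base a p) ![mfderiv (𝓡 (2 * n + 2)) (𝓡 (2 * n + 1)) (P.base a) p x] =
      P.dHeight a p y ∧
    0 ≤ extD (P.lam a) (P.base a p)
      ![mfderiv (𝓡 (2 * n + 2)) (𝓡 (2 * n + 1)) (P.base a) p y,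
        mfderiv (𝓡 (2 * n + 2)) (𝓡 (2 * n + 1)) (P.base a) p x] := by
  obtain ⟨I, hI, hJ⟩ := P.cylindrical a t ht
  obtain ⟨r, hr1, hr2⟩ := (P.contact a).exists_isReebVector (P.base a p)
  set l := P.lam a (P.base a p) with hl
  set o := extD (P.lam a) (P.base a p) with ho
  set dx := mfderiv (𝓡 (2 * n + 2)) (𝓡 (2 * n + 1)) (P.base a) p with hdx
  set da : TangentSpace (𝓡 (2 * n + 2)) p →L[ℝ] ℝ :=
    mfderiv (𝓡 (2 * n + 2)) 𝓘(ℝ, ℝ) (P.height a) p with hda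
  set b : ℝ := l ![dx x] with hb
  -- Split `dx x = b • r + k` into its Reeb and contact parts. The form of `J` then gives `dx y =
  -- -(da x • r + I k)` and `da y = b`, from which all three claims are read off; the last one
  -- reduces to `d lam(k, I k) ≥ 0`.
  set k : TangentSpace (𝓡 (2 * n + 1)) (P.base a p) := dx x + -(b • r) with hk
  have hk0 : l ![k] = 0 := by
    rw [hk, oneForm_add, oneForm_neg, oneForm_smul, hr1]; ring
  have hdec : dx x = b • r + k := by rw [hk]; abel
  obtain ⟨h1, h2⟩ := hJ p hp r k ⟨hr1, hr2⟩ hk0 (da x) b x rfl hdec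
  have hy : y = -(P.J t p x) := eq_neg_of_add_eq_zero_left h
  have hIk : l ![I (P.base a p) k] = 0 := hI.preserves _ k hk0
  have hdxy : dx y = -(da x • r + I (P.base a p) k) := by
    rw [hy, map_neg]; exact congrArg Neg.neg h2
  have hday : da y = b := by
    rw [hy, map_neg]
    have : da (P.J t p x) = -b := h1
    rw [this, neg_neg]
  refine ⟨?_, hday.symm, ?_⟩
  · rw [hdxy, oneForm_neg, oneForm_add, oneForm_smul, hr1, hIk]
    change -(da x * 1 + 0) = -da x
    ring
  · rw [hdxy, hdec, twoForm_neg_left, twoForm_add_left, twoForm_smul_left, hr2,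
      twoForm_add_right, twoForm_smul_right, twoForm_swap o (I _ k) r, hr2,
      twoForm_swap o (I _ k) k]
    have : 0 ≤ o ![k, I (P.base a p) k] := by
      by_cases hk' : k = 0
      · rw [hk', map_zero]; exact (twoForm_self o 0).ge
      · exact (hI.pos _ k hk0 hk').le
    linarith

/-- Here `d(e^α lam) = e^α (dα ∧ lam + d lam)`, and the Cauchy-Riemann equations turn `dα ∧ lam`
into the squared gradient of `α`. -/
theorem symplectic_eq_of_mem_endSet {p : X} (hp : p ∈ P.endSet a)
    {y x : TangentSpace (𝓡 (2 * n + 2)) p}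
    (h1 : P.lam a (P.base a p) ![mfderiv (𝓡 (2 * n + 2)) (𝓡 (2 * n + 1)) (P.base a) p y] =
      -P.dHeight a p x)
    (h2 : P.lam a (P.base a p) ![mfderiv (𝓡 (2 * n + 2)) (𝓡 (2 * n + 1)) (P.base a) p x] =
      P.dHeight a p y) :
    P.Om p ![y, x] = Real.exp (P.height a p) *
      (P.dHeight a p y ^ 2 +
        P.dHeight a p x ^ 2 +
      extD (P.lam a) (P.base a p)
      ![mfderiv (𝓡 (2 * n + 2)) (𝓡 (2 * n + 1)) (P.base a) p y,
        mfderiv (𝓡 (2 * n + 2)) (𝓡 (2 * n + 1)) (P.base a) p x]) := by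
  have h := (P.concaveEnd a).symplectic p hp y x
  rw [h, dScaled, Real.deriv_exp]
  change Real.exp (P.height a p) * (P.dHeight a p y *
    P.lam a (P.base a p) ![mfderiv (𝓡 (2 * n + 2)) (𝓡 (2 * n + 1)) (P.base a) p x] -
    P.dHeight a p x *
    P.lam a (P.base a p) ![mfderiv (𝓡 (2 * n + 2)) (𝓡 (2 * n + 1)) (P.base a) p y]) +
    Real.exp (P.height a p) * extD (P.lam a) (P.base a p)
      ![mfderiv (𝓡 (2 * n + 2)) (𝓡 (2 * n + 1)) (P.base a) p y,
        mfderiv (𝓡 (2 * n + 2)) (𝓡 (2 * n + 1)) (P.base a) p x] = _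
  rw [h1, h2]
  ring

variable {u : ℂ → X}

theorem IsStrip.contMDiffWithinAt_height (hu : P.IsStrip u) {z : ℂ} (hz : z ∈ strip)
    (hzs : u z ∈ P.endSet a) :
    ContDiffWithinAt ℝ ∞ (fun y => P.height a (u y)) strip z :=
  ((contMDiffAt_height hzs).comp_contMDiffWithinAt z (hu.smooth z hz)).contDiffWithinAt

theorem IsStrip.contMDiffWithinAt_base (hu : P.IsStrip u) {z : ℂ} (hz : z ∈ strip)
    (hzs : u z ∈ P.endSet a) :
    ContMDiffWithinAt 𝓘(ℝ, ℂ) (𝓡 (2 * n + 1)) ∞ (fun y => P.base a (u y)) strip z :=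
  (contMDiffAt_base hzs).comp_contMDiffWithinAt z (hu.smooth z hz)

theorem IsStrip.fderivWithin_height (hu : P.IsStrip u) {z : ℂ} (hz : z ∈ strip)
    (hzs : u z ∈ P.endSet a) (ζ : ℂ) :
    fderivWithin ℝ (fun y => P.height a (u y)) strip z ζ =
      P.dHeight a (u z) (partialD (2 * n + 2) strip u z ζ) := by
  have h := mfderiv_comp_mfderivWithin z ((contMDiffAt_height hzs).mdifferentiableAt (by simp))
    ((hu.smooth z hz).mdifferentiableWithinAt (by simp)) (uniqueMDiffOn_strip z hz)
  rw [← mfderivWithin_eq_fderivWithin]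
  exact congrArg (fun L : ℂ →L[ℝ] ℝ => L ζ) h

theorem IsStrip.partialD_base (hu : P.IsStrip u) {z : ℂ} (hz : z ∈ strip)
    (hzs : u z ∈ P.endSet a) (ζ : ℂ) :
    partialD (2 * n + 1) strip (fun y => P.base a (u y)) z ζ =
      mfderiv (𝓡 (2 * n + 2)) (𝓡 (2 * n + 1)) (P.base a) (u z)
        (partialD (2 * n + 2) strip u z ζ) := by
  have h := mfderiv_comp_mfderivWithin z ((contMDiffAt_base hzs).mdifferentiableAt (by simp))
    ((hu.smooth z hz).mdifferentiableWithinAt (by simp)) (uniqueMDiffOn_strip z hz)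
  exact congrArg (fun L : ℂ →L[ℝ] EuclideanSpace ℝ (Fin (2 * n + 1)) => L ζ) h

theorem IsStrip.cauchyRiemann (hu : P.IsStrip u) {z : ℂ} (hz : z ∈ strip)
    (hzs : u z ∈ P.endSet a) :
    P.lam a (P.base a (u z)) ![partialD (2 * n + 1) strip (fun y => P.base a (u y)) z 1] =
      -fderivWithin ℝ (fun y => P.height a (u y)) strip z Complex.I ∧
    P.lam a (P.base a (u z)) ![partialD (2 * n + 1) strip (fun y => P.base a (u y)) z Complex.I] =
      fderivWithin ℝ (fun y => P.height a (u y)) strip z 1 ∧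
    0 ≤ extD (P.lam a) (P.base a (u z))
      ![partialD (2 * n + 1) strip (fun y => P.base a (u y)) z 1,
        partialD (2 * n + 1) strip (fun y => P.base a (u y)) z Complex.I] ∧
    P.Om (u z) ![partialD (2 * n + 2) strip u z 1, partialD (2 * n + 2) strip u z Complex.I] =
      Real.exp (P.height a (u z)) *
        (fderivWithin ℝ (fun y => P.height a (u y)) strip z 1 ^ 2 +
          fderivWithin ℝ (fun y => P.height a (u y)) strip z Complex.I ^ 2 +
          extD (P.lam a) (P.base a (u z))
            ![partialD (2 * n + 1) strip (fun y => P.base a (u y)) z 1,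
              partialD (2 * n + 1) strip (fun y => P.base a (u y)) z Complex.I]) := by
  rw [hu.partialD_base hz hzs, hu.partialD_base hz hzs, hu.fderivWithin_height hz hzs,
    hu.fderivWithin_height hz hzs]
  have h := cauchyRiemann_of_mem_endSet hz hzs (hu.holomorphic z hz)
  exact ⟨h.1, h.2.1, h.2.2, symplectic_eq_of_mem_endSet hzs h.1 h.2.1⟩

theorem IsStrip.isOpen_domain (hu : P.IsStrip u) : IsOpen (openStrip ∩ u ⁻¹' P.endSet a) :=
  (hu.smooth.continuousOn.mono openStrip_subset_strip).isOpen_inter_preimage isOpen_openStrip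
    (P.isOpen_endSet a)

theorem IsStrip.contDiffAt_height (hu : P.IsStrip u) {z : ℂ} (hz : z ∈ openStrip)
    (hzs : u z ∈ P.endSet a) : ContDiffAt ℝ ∞ (fun y => P.height a (u y)) z :=
  (hu.contMDiffWithinAt_height (openStrip_subset_strip hz) hzs).contDiffAt (strip_mem_nhds hz)

/-- On the interior of the strip, `d lam(x_τ, x_t) = Δα`. -/
theorem IsStrip.extD_eq_lap_height [∀ a, IsManifold (𝓡 (2 * n + 1)) ∞ (M a)] (hu : P.IsStrip u)
    {z : ℂ} (hz : z ∈ openStrip) (hzs : u z ∈ P.endSet a) :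
    extD (P.lam a) (P.base a (u z))
      ![partialD (2 * n + 1) strip (fun y => P.base a (u y)) z 1,
        partialD (2 * n + 1) strip (fun y => P.base a (u y)) z Complex.I] =
      lap (fun y => P.height a (u y)) z := by
  have hpd : ∀ y ∈ openStrip, ∀ ζ : ℂ,
      partialD (2 * n + 1) strip (fun y => P.base a (u y)) y ζ =
        mfderiv 𝓘(ℝ, ℂ) (𝓡 (2 * n + 1)) (fun y => P.base a (u y)) y ζ := by
    intro y hy ζ
    rw [partialD, mfderivWithin_of_mem_nhds (strip_mem_nhds hy)]
  have hev := hu.isOpen_domain.mem_nhds (⟨hz, hzs⟩ : z ∈ openStrip ∩ u ⁻¹' P.endSet a)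
  rw [hpd z hz, hpd z hz]
  refine extD_eq_lap (P.contact a).smooth
    ((hu.contMDiffWithinAt_base (openStrip_subset_strip hz) hzs).contMDiffAt (strip_mem_nhds hz))
    ((hu.contDiffAt_height hz hzs).of_le (by norm_cast)) ?_ ?_
  · filter_upwards [hev] with y hy
    have h := (hu.cauchyRiemann (openStrip_subset_strip hy.1) hy.2).1
    rw [hpd y hy.1, fderivWithin_of_mem_nhds (strip_mem_nhds hy.1)] at h
    exact h
  · filter_upwards [hev] with y hy
    have h := (hu.cauchyRiemann (openStrip_subset_strip hy.1) hy.2).2.1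
    rw [hpd y hy.1, fderivWithin_of_mem_nhds (strip_mem_nhds hy.1)] at h
    exact h

theorem IsStrip.lap_height_nonneg [∀ a, IsManifold (𝓡 (2 * n + 1)) ∞ (M a)] (hu : P.IsStrip u)
    {z : ℂ} (hz : z ∈ openStrip) (hzs : u z ∈ P.endSet a) :
    0 ≤ lap (fun y => P.height a (u y)) z := by
  rw [← hu.extD_eq_lap_height hz hzs]
  exact (hu.cauchyRiemann (openStrip_subset_strip hz) hzs).2.2.1

/-- On the interior of the strip, the density of `u^*Om` is `Δ e^α`. -/
theorem IsStrip.symplectic_eq_density [∀ a, IsManifold (𝓡 (2 * n + 1)) ∞ (M a)] (hu : P.IsStrip u)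
    {z : ℂ} (hz : z ∈ openStrip) (hzs : u z ∈ P.endSet a) :
    P.Om (u z) ![partialD (2 * n + 2) strip u z 1, partialD (2 * n + 2) strip u z Complex.I] =
      density Real.exp (fun y => P.height a (u y)) z := by
  rw [(hu.cauchyRiemann (openStrip_subset_strip hz) hzs).2.2.2, hu.extD_eq_lap_height hz hzs,
    fderivWithin_of_mem_nhds (strip_mem_nhds hz), density, Real.deriv_exp, gradSq]
  ring

/-- Along the boundary lines the normal derivative of `α` vanishes. -/
theorem IsStrip.fderivWithin_height_boundary (hu : P.IsStrip u) {z : ℂ}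
    (hz : z.im = 0 ∨ z.im = 1) (hzs : u z ∈ P.endSet a) :
    fderivWithin ℝ (fun y => P.height a (u y)) strip z Complex.I = 0 := by
  have hmem : ∀ s : ℝ, z + s ∈ strip := by
    intro s
    rcases hz with h | h <;> simp [strip, h]
  have hzst : z ∈ strip := by simpa using hmem 0
  obtain ⟨i, hi⟩ : ∃ i, ∀ s : ℝ, u (z + s) ∈ P.L i := by
    rcases hz with h | h
    · exact ⟨0, fun s => hu.lower _ (by simp [h])⟩
    · exact ⟨1, fun s => hu.upper _ (by simp [h])⟩
  -- By the equation `lam(x_τ) = -α_t` it is enough that `lam` vanishes on `x_τ`, and `x_τ` is the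
  -- velocity of a boundary curve inside a Legendrian submanifold.
  suffices h : P.lam a (P.base a (u z))
      ![partialD (2 * n + 1) strip (fun y => P.base a (u y)) z 1] = 0 by
    have h' := (hu.cauchyRiemann hzst hzs).1
    rw [h] at h'
    linarith
  have hz0 : z + ((0 : ℝ) : ℂ) = z := by simp
  have hc : ContinuousAt (fun s : ℝ => u (z + s)) 0 := by
    rw [← continuousWithinAt_univ]
    refine ContinuousWithinAt.comp (t := strip) ?_ (by fun_prop) (fun s _ => hmem s)
    rw [hz0]
    exact hu.smooth.continuousOn z hzst
  have hev : ∀ᶠ s : ℝ in 𝓝 0, P.base a (u (z + s)) ∈ P.Leg a i := by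
    have : P.endSet a ∈ 𝓝 (u (z + ((0 : ℝ) : ℂ))) := by
      rw [hz0]; exact (P.isOpen_endSet a).mem_nhds hzs
    filter_upwards [hc.preimage_mem_nhds this] with s hs
    exact (P.cone a i _ hs).1 (hi s)
  have hline : HasMFDerivAt 𝓘(ℝ, ℝ) 𝓘(ℝ, ℂ) (fun s : ℝ => z + s) 0
      (ContinuousLinearMap.toSpanSingleton ℝ (1 : ℂ)) := by
    have : HasDerivAt (fun s : ℝ => z + (s : ℂ)) 1 0 :=
      (Complex.ofRealCLM.hasDerivAt (x := 0)).const_add z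
    exact this.hasFDerivAt.hasMFDerivAt
  -- The base point `z₀` is kept free so that the equation `z + 0 = z₀` can be eliminated inside the
  -- dependent types.
  have hder : ∀ z₀, z + ((0 : ℝ) : ℂ) = z₀ → z₀ ∈ strip → u z₀ ∈ P.endSet a →
      HasMFDerivAt 𝓘(ℝ, ℝ) (𝓡 (2 * n + 1)) (fun s : ℝ => P.base a (u (z + s))) 0
      (ContinuousLinearMap.toSpanSingleton ℝ
        (partialD (2 * n + 1) strip (fun y => P.base a (u y)) z₀ 1 :
          EuclideanSpace ℝ (Fin (2 * n + 1))) : ℝ →L[ℝ] EuclideanSpace ℝ (Fin (2 * n + 1))) := by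
    rintro _ rfl h1 h2
    have h3 := ((hu.contMDiffWithinAt_base h1 h2).mdifferentiableWithinAt
      (by simp)).hasMFDerivWithinAt
    have h4 := HasMFDerivWithinAt.comp (s := univ) (u := strip) (0 : ℝ) h3 hline.hasMFDerivWithinAt
      (fun s _ => hmem s)
    rw [hasMFDerivWithinAt_univ] at h4
    refine h4.congr_mfderiv ?_
    refine ContinuousLinearMap.ext fun s => ?_
    let D : ℂ →L[ℝ] EuclideanSpace ℝ (Fin (2 * n + 1)) :=
      mfderivWithin 𝓘(ℝ, ℂ) (𝓡 (2 * n + 1)) (fun y => P.base a (u y)) strip (z + ((0 : ℝ) : ℂ))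
    exact D.map_smul s 1
  exact (P.legendrian a i).tangent _ ((P.cone a i _ hzs).1 (by simpa using hi 0)) _
    (mem_tangentVectors_of_hasMFDerivAt (congrArg (fun y => P.base a (u y)) hz0) hev (hder z hz0 hzst hzs))

end LagrangianPair

/-! ### The energy estimate for a single strip -/

theorem lap_congr {f g : ℂ → ℝ} {z : ℂ} (h : f =ᶠ[𝓝 z] g) : lap f z = lap g z := by
  unfold lap
  rw [h.fderiv.fderiv_eq]

theorem lap_zero (z : ℂ) : lap (fun _ => (0 : ℝ)) z = 0 := by
  simp [lap]

namespace LagrangianPair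

variable {n : ℕ} {X : Type*} [TopologicalSpace X]
  [ChartedSpace (EuclideanSpace ℝ (Fin (2 * n + 2))) X] [IsManifold (𝓡 (2 * n + 2)) ∞ X]
  {A : Type*} {M : A → Type*} [∀ a, TopologicalSpace (M a)]
  [∀ a, ChartedSpace (EuclideanSpace ℝ (Fin (2 * n + 1))) (M a)]

/-- The function `θ(α)` on the end `a`, extended by zero to `X`. -/
def extendByZero (P : LagrangianPair n X M) (a : A) (θ : ℝ → ℝ) : X → ℝ :=
  (P.endSet a).indicator fun p => θ (P.height a p)

variable {P : LagrangianPair n X M} {a : A}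

theorem extendByZero_eventuallyEq (θ : ℝ → ℝ) {p : X} (hp : p ∈ P.endSet a) :
    P.extendByZero a θ =ᶠ[𝓝 p] fun p => θ (P.height a p) := by
  filter_upwards [(P.isOpen_endSet a).mem_nhds hp] with q hq using indicator_of_mem hq _

/-- The set `α ≤ d` is closed in `X`, so a point outside the end has a neighbourhood which meets the
end only where `α > d`, and there `θ` vanishes. -/
theorem extendByZero_eventuallyEq_zero {θ : ℝ → ℝ} {d : ℝ} (hd : d < P.R a)
    (hθ : ∀ s, d ≤ s → θ s = 0) {p : X} (hp : p ∉ P.endSet a) :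
    P.extendByZero a θ =ᶠ[𝓝 p] fun _ => 0 := by
  have hcl := (P.concaveEnd a).closed d hd
  filter_upwards [hcl.isOpen_compl.mem_nhds (fun h => hp h.1)] with q hq
  by_cases hqs : q ∈ P.endSet a
  · rw [extendByZero, indicator_of_mem hqs]
    exact hθ _ (not_le.1 fun h => hq ⟨hqs, h⟩).le
  · exact indicator_of_notMem hqs _

theorem contMDiff_extendByZero {θ : ℝ → ℝ} (hθs : ContDiff ℝ ∞ θ) {d : ℝ} (hd : d < P.R a)
    (hθ : ∀ s, d ≤ s → θ s = 0) :
    ContMDiff (𝓡 (2 * n + 2)) 𝓘(ℝ, ℝ) ∞ (P.extendByZero a θ) := by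
  intro p
  by_cases hp : p ∈ P.endSet a
  · exact ContMDiffAt.congr_of_eventuallyEq
      ((hθs.contMDiff.contMDiffAt).comp p (contMDiffAt_height hp)) (extendByZero_eventuallyEq θ hp)
  · exact ContMDiffAt.congr_of_eventuallyEq contMDiffAt_const
      (extendByZero_eventuallyEq_zero hd hθ hp)

variable {u : ℂ → X}

/-- Since `u_τ = -J u_t`, the density equals `Om(u_t, J u_t)`. -/
theorem IsStrip.symplectic_nonneg (hu : P.IsStrip u) {z : ℂ} (hz : z ∈ strip) :
    0 ≤ P.Om (u z) ![partialD (2 * n + 2) strip u z 1,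
      partialD (2 * n + 2) strip u z Complex.I] := by
  set v := partialD (2 * n + 2) strip u z Complex.I with hv
  rw [eq_neg_of_add_eq_zero_left (hu.holomorphic z hz), twoForm_neg_left, ← twoForm_swap]
  by_cases h : v = 0
  · have h0 : P.J z.im (u z) v = 0 := by rw [h]; exact map_zero _
    rw [h0, h]
    exact (twoForm_self _ 0).ge
  · exact (P.compatible.pos z.im hz _ v h).le

/-- The part of the open strip on which `u` lies in the end `a` and `b < α < d`. -/
def slab (P : LagrangianPair n X M) (a : A) (u : ℂ → X) (b d : ℝ) : Set ℂ :=
  (openStrip ∩ u ⁻¹' P.endSet a) ∩ (fun z => P.height a (u z)) ⁻¹' Ioo b d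

theorem IsStrip.isOpen_slab (hu : P.IsStrip u) (a : A) (b d : ℝ) : IsOpen (P.slab a u b d) :=
  ContinuousOn.isOpen_inter_preimage
    (fun _ hz => (hu.contDiffAt_height hz.1 hz.2).continuousAt.continuousWithinAt)
    hu.isOpen_domain isOpen_Ioo

/-- The energy with respect to `d(φ lam)` of the part of a strip in a sublevel set of an end is
bounded by its symplectic energy. -/
theorem IsStrip.lintegral_density_le [∀ a, IsManifold (𝓡 (2 * n + 1)) ∞ (M a)] (hu : P.IsStrip u)
    {φ : ℝ → ℝ} (hφ : φ ∈ monotoneCutoffs) {b c d' : ℝ} (hd' : d' < P.R a) :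
    ∫⁻ z in P.slab a u b d',
      ENNReal.ofReal (density (fun s => φ (s - c)) (fun y => P.height a (u y)) z) ≤
      ENNReal.ofReal (Real.exp (-d')) * symplecticEnergy P.Om u := by
  rcases le_or_gt d' b with hb | hb
  · have : P.slab a u b d' = ∅ := by rw [slab, Ioo_eq_empty_of_le hb, preimage_empty, inter_empty]
    rw [this]; simp
  -- The profile needs room above `d'` to reach the exponential, at a level `d` still below `R`, so
  -- that the primitive extends by zero outside the end.
  obtain ⟨d, hd1, hd2⟩ := exists_between hd'
  set θ := profilePrimitive φ b c d' d with hθ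
  set g : ℂ → ℝ := fun y => P.height a (u y) with hg
  set w : ℂ → ℝ := fun y => P.extendByZero a θ (u y) with hw
  have hθs : ContDiff ℝ ∞ θ := contDiff_profilePrimitive hφ
  have hθ0 : ∀ s, d ≤ s → θ s = 0 := fun s hs => profilePrimitive_eq_zero hd1 hb.le hs
  obtain ⟨B, hB⟩ := exists_abs_profilePrimitive_le (c := c) hφ hd1 hb.le
  have hws : ContDiffOn ℝ ∞ w strip := by
    rw [← contMDiffOn_iff_contDiffOn]
    exact (contMDiff_extendByZero hθs hd2 hθ0).comp_contMDiffOn hu.smooth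
  have hwB : ∀ z ∈ strip, |w z| ≤ B := by
    intro z _
    by_cases h : u z ∈ P.endSet a
    · simp only [hw, extendByZero, indicator_of_mem h]; exact hB _
    · simp only [hw, extendByZero, indicator_of_notMem h, abs_zero]
      exact (abs_nonneg _).trans (hB 0)
  have hstrip : ∀ z : ℂ, z.im = 0 ∨ z.im = 1 → z ∈ strip := by
    rintro z (h | h) <;> simp [strip, h]
  have hwin : ∀ z ∈ strip, u z ∈ P.endSet a → w =ᶠ[𝓝[strip] z] fun y => θ (g y) := fun z hz h =>
    (hu.smooth.continuousOn z hz).eventually (extendByZero_eventuallyEq θ h)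
  have hwout : ∀ z ∈ strip, u z ∉ P.endSet a → w =ᶠ[𝓝[strip] z] fun _ => 0 := fun z hz h =>
    (hu.smooth.continuousOn z hz).eventually (extendByZero_eventuallyEq_zero hd2 hθ0 h)
  have hneu : ∀ z : ℂ, z.im = 0 ∨ z.im = 1 → fderivWithin ℝ w strip z Complex.I = 0 := by
    intro z hz
    have hzs := hstrip z hz
    by_cases h : u z ∈ P.endSet a
    · have h1 := ((hu.contMDiffWithinAt_height hzs h).differentiableWithinAt
        (by simp)).hasFDerivWithinAt
      have h2 := ((hθs.differentiable (by simp)).differentiableAt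
        (x := g z)).hasDerivAt.comp_hasFDerivWithinAt z h1
      rw [(hwin z hzs h).fderivWithin_eq_of_mem hzs]
      have h3 := h2.fderivWithin (uniqueDiffOn_strip z hzs)
      have h4 := congrArg (fun L : ℂ →L[ℝ] ℝ => L Complex.I) h3
      refine h4.trans ?_
      rw [smul_apply, hu.fderivWithin_height_boundary hz h, smul_zero]
    · rw [(hwout z hzs h).fderivWithin_eq_of_mem hzs]
      simp
  have hnhds : ∀ z ∈ openStrip, 𝓝[strip] z = 𝓝 z := fun z hz =>
    nhdsWithin_eq_nhds.2 (strip_mem_nhds hz)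
  -- The symplectic density is the density of `exp` and `Δw` is that of `profile - exp`; the
  -- exponential cancels.
  have hlap : ∀ z ∈ openStrip, u z ∈ P.endSet a →
      P.Om (u z) ![partialD (2 * n + 2) strip u z 1, partialD (2 * n + 2) strip u z Complex.I] +
        lap w z = density (profile φ b c d' d) g z := by
    intro z hz h
    have h1 := hwin z (openStrip_subset_strip hz) h
    rw [hnhds z hz] at h1
    rw [lap_congr h1, lap_comp (hθs.of_le (by norm_cast))
      ((hu.contDiffAt_height hz h).of_le (by norm_cast)), deriv_profilePrimitive hφ,
      density_sub ((contDiff_profile hφ).differentiable (by simp)) Real.differentiable_exp,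
      hu.symplectic_eq_density hz h]
    ring
  have hnonneg : ∀ z ∈ openStrip, u z ∈ P.endSet a → 0 ≤ density (profile φ b c d' d) g z := by
    intro z hz h
    exact add_nonneg (mul_nonneg (deriv_profile_nonneg hφ hd1 _) (gradSq_nonneg _ _))
      (mul_nonneg (profile_nonneg hφ _) (hu.lap_height_nonneg hz h))
  -- The profile density is kept on the slab only. Discarding the rest is harmless: elsewhere in the
  -- end the profile density is non-negative, and outside the end `Δw = 0` and the symplectic
  -- density is non-negative.
  have hmain := lintegral_openStrip_le hws hwB hneu
    (g := (P.slab a u b d').indicator (density (profile φ b c d' d) g))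
    (e := fun z => P.Om (u z) ![partialD (2 * n + 2) strip u z 1,
      partialD (2 * n + 2) strip u z Complex.I]) (by
    intro z hz
    by_cases h : u z ∈ P.endSet a
    · rw [hlap z hz h]
      exact ⟨indicator_nonneg (fun z hz => hnonneg z hz.1.1 hz.1.2) z,
        indicator_apply_le' (fun _ => le_rfl) (fun _ => hnonneg z hz h)⟩
    · have h1 := hwout z (openStrip_subset_strip hz) h
      rw [hnhds z hz] at h1
      rw [indicator_of_notMem (fun h' => h h'.1.2), lap_congr h1, lap_zero, add_zero]
      exact ⟨le_rfl, hu.symplectic_nonneg (openStrip_subset_strip hz)⟩)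
  have hm : MeasurableSet (P.slab a u b d') := (hu.isOpen_slab a b d').measurableSet
  have hscale : ∫⁻ z in P.slab a u b d',
      ENNReal.ofReal (density (fun s => φ (s - c)) g z) =
      ∫⁻ z in P.slab a u b d', ENNReal.ofReal (Real.exp (-d')) *
        ENNReal.ofReal ((P.slab a u b d').indicator (density (profile φ b c d' d) g) z) := by
    refine setLIntegral_congr_fun hm fun z hz => ?_
    rw [indicator_of_mem hz, ← ENNReal.ofReal_mul (Real.exp_pos _).le,
      density_profile hφ hd1 hz.2.1 hz.2.2, ← mul_assoc, ← Real.exp_add, neg_add_cancel,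
      Real.exp_zero, one_mul]
  rw [hscale, lintegral_const_mul' _ _ ENNReal.ofReal_ne_top]
  gcongr
  exact (lintegral_mono_set fun z hz => hz.1.1).trans hmain

end LagrangianPair

/-! ### Pointwise consequences of smooth convergence -/

section Components

variable {E : Type*} [NormedAddCommGroup E] [NormedSpace ℝ E] {G : ℂ → ℝ × E} {z : ℂ}

theorem fderiv_fst_apply (hG : DifferentiableAt ℝ G z) (ζ : ℂ) :
    fderiv ℝ (fun y => (G y).1) z ζ = (fderiv ℝ G z ζ).1 :=
  congrArg (fun L : ℂ →L[ℝ] ℝ => L ζ) hG.hasFDerivAt.fst.fderiv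

theorem fderiv_snd_apply (hG : DifferentiableAt ℝ G z) (ζ : ℂ) :
    fderiv ℝ (fun y => (G y).2) z ζ = (fderiv ℝ G z ζ).2 :=
  congrArg (fun L : ℂ →L[ℝ] E => L ζ) hG.hasFDerivAt.snd.fderiv

theorem fderiv_fderiv_fst_apply (hG : ContDiffAt ℝ 2 G z) (ζ ξ : ℂ) :
    fderiv ℝ (fderiv ℝ fun y => (G y).1) z ζ ξ = (fderiv ℝ (fderiv ℝ G) z ζ ξ).1 := by
  have h1 : DifferentiableAt ℝ (fderiv ℝ G) z :=
    (hG.fderiv_right (m := 1) (by norm_num)).differentiableAt (by norm_num)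
  have h2 : (fderiv ℝ fun y => (G y).1) =ᶠ[𝓝 z]
      fun y => (ContinuousLinearMap.fst ℝ ℝ E).comp (fderiv ℝ G y) := by
    filter_upwards [hG.eventually (by simp)] with y hy
    exact (hy.differentiableAt (by norm_num)).hasFDerivAt.fst.fderiv
  have h3 := (hasFDerivAt_const (ContinuousLinearMap.fst ℝ ℝ E) z).clm_comp h1.hasFDerivAt
  rw [h2.fderiv_eq, h3.fderiv]
  simp

end Components

variable {m : ℕ} {N : Type*} [TopologicalSpace N] [ChartedSpace (EuclideanSpace ℝ (Fin m)) N]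

/-- A map to `ℝ × N`, read in the chart at `q`. -/
def inChart (m : ℕ) {N : Type*} [TopologicalSpace N] [ChartedSpace (EuclideanSpace ℝ (Fin m)) N]
    (q : ℝ × N) (f : ℂ → ℝ × N) (y : ℂ) : ℝ × EuclideanSpace ℝ (Fin m) :=
  ((f y).1, extChartAt (𝓡 m) q.2 (f y).2)

theorem extChartAt_comp_eq_inChart (q : ℝ × N) (f : ℂ → ℝ × N) :
    extChartAt (𝓘(ℝ, ℝ).prod (𝓡 m)) q ∘ f = inChart m q f := by
  funext y
  simp only [Function.comp_apply, inChart, extChartAt_prod, extChartAt_model_space_eq_id]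
  rfl

theorem snd_mem_source_of_mem_source {q p : ℝ × N}
    (h : p ∈ (extChartAt (𝓘(ℝ, ℝ).prod (𝓡 m)) q).source) :
    p.2 ∈ (extChartAt (𝓡 m) q.2).source := by
  rw [extChartAt_prod] at h
  exact h.2

/-- The Cauchy-Riemann equations `lam(x_τ) = -b_t`, `lam(x_t) = b_τ` of a map `(b, x)`. -/
def SatisfiesCR (lam : DiffForm m N 1) (f : ℂ → ℝ × N) (z : ℂ) : Prop :=
  lam (f z).2 ![mfderiv 𝓘(ℝ, ℂ) (𝓡 m) (fun y => (f y).2) z (1 : ℂ)] =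
    -fderiv ℝ (fun y => (f y).1) z Complex.I ∧
  lam (f z).2 ![mfderiv 𝓘(ℝ, ℂ) (𝓡 m) (fun y => (f y).2) z Complex.I] =
    fderiv ℝ (fun y => (f y).1) z 1

section Limits

variable {D : Set ℂ} {f : ℕ → ℂ → ℝ × N} {v : ℂ → ℝ × N} {z : ℂ}

/-- At interior points of `D`, derivatives within `D` are ordinary ones. Pointwise convergence there
is all that Fatou's lemma requires, as the boundary of `D` is a null set. -/
theorem ConvergesSmoothly.tendsto_iteratedFDeriv (h : ConvergesSmoothly m D f v) (hz : D ∈ 𝓝 z)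
    (j : ℕ) (e : Fin j → ℂ) :
    Tendsto (fun k => iteratedFDeriv ℝ j (inChart m (v z) (f k)) z e) atTop
      (𝓝 (iteratedFDeriv ℝ j (inChart m (v z) v) z e)) := by
  have hzD := mem_of_mem_nhds hz
  obtain ⟨W, hW, -, -, hlim⟩ := h.2 z hzD
  have h1 := (hlim j).tendsto_at (mem_of_mem_nhdsWithin hzD hW)
  have huniv : D =ᶠ[𝓝 z] univ := eventuallyEq_univ.2 hz
  simp only [extChartAt_comp_eq_inChart, iteratedFDerivWithin_congr_set huniv,
    iteratedFDerivWithin_univ] at h1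
  exact h1.eval_const e

theorem ConvergesSmoothly.eventually_mem_source (h : ConvergesSmoothly m D f v) (hz : z ∈ D) :
    ∀ᶠ k in atTop, (f k z).2 ∈ (extChartAt (𝓡 m) (v z).2).source := by
  obtain ⟨W, hW, -, hk, -⟩ := h.2 z hz
  filter_upwards [hk] with k hk
  exact snd_mem_source_of_mem_source (hk (mem_of_mem_nhdsWithin hz hW))

theorem ConvergesSmoothly.contDiffAt_fst (h : ConvergesSmoothly m D f v) (hz : D ∈ 𝓝 z) :
    ContDiffAt ℝ ∞ (fun y => (v y).1) z :=
  (contMDiffAt_fst.comp z (h.1.contMDiffAt hz)).contDiffAt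

theorem ConvergesSmoothly.contMDiffAt_snd (h : ConvergesSmoothly m D f v) (hz : D ∈ 𝓝 z) :
    ContMDiffAt 𝓘(ℝ, ℂ) (𝓡 m) ∞ (fun y => (v y).2) z :=
  ContMDiffAt.comp z _root_.contMDiffAt_snd (h.1.contMDiffAt hz)

theorem ConvergesSmoothly.tendsto_inChart (h : ConvergesSmoothly m D f v) (hz : D ∈ 𝓝 z) :
    Tendsto (fun k => inChart m (v z) (f k) z) atTop (𝓝 (inChart m (v z) v z)) :=
  h.tendsto_iteratedFDeriv hz 0 ![]

theorem ConvergesSmoothly.tendsto_fst (h : ConvergesSmoothly m D f v) (hz : D ∈ 𝓝 z) :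
    Tendsto (fun k => (f k z).1) atTop (𝓝 (v z).1) :=
  (h.tendsto_inChart hz).fst_nhds

theorem ConvergesSmoothly.tendsto_fderiv (h : ConvergesSmoothly m D f v) (hz : D ∈ 𝓝 z) (ζ : ℂ) :
    Tendsto (fun k => fderiv ℝ (inChart m (v z) (f k)) z ζ) atTop
      (𝓝 (fderiv ℝ (inChart m (v z) v) z ζ)) := by
  have := h.tendsto_iteratedFDeriv hz 1 ![ζ]
  simpa [iteratedFDeriv_one_apply] using this

theorem ConvergesSmoothly.tendsto_fderiv_fderiv (h : ConvergesSmoothly m D f v) (hz : D ∈ 𝓝 z)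
    (ζ ξ : ℂ) :
    Tendsto (fun k => fderiv ℝ (fderiv ℝ (inChart m (v z) (f k))) z ζ ξ) atTop
      (𝓝 (fderiv ℝ (fderiv ℝ (inChart m (v z) v)) z ζ ξ)) := by
  have := h.tendsto_iteratedFDeriv hz 2 ![ζ, ξ]
  simpa [iteratedFDeriv_two_apply] using this

variable [IsManifold (𝓡 m) ∞ N]

theorem contDiffAt_inChart {q : ℝ × N} {f : ℂ → ℝ × N} {z : ℂ}
    (h1 : ContDiffAt ℝ ∞ (fun y => (f y).1) z)
    (h2 : ContMDiffAt 𝓘(ℝ, ℂ) (𝓡 m) ∞ (fun y => (f y).2) z)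
    (hq : (f z).2 ∈ (extChartAt (𝓡 m) q.2).source) : ContDiffAt ℝ ∞ (inChart m q f) z := by
  have h : ContMDiffAt (𝓡 m) 𝓘(ℝ, EuclideanSpace ℝ (Fin m)) ∞ (extChartAt (𝓡 m) q.2) (f z).2 :=
    contMDiffAt_extChartAt' (by rwa [extChartAt_source] at hq)
  exact h1.prodMk (h.comp z h2).contDiffAt

theorem ConvergesSmoothly.contDiffAt_inChart_limit (h : ConvergesSmoothly m D f v)
    (hz : D ∈ 𝓝 z) : ContDiffAt ℝ ∞ (inChart m (v z) v) z :=
  contDiffAt_inChart (h.contDiffAt_fst hz) (h.contMDiffAt_snd hz) (mem_extChartAt_source _)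

theorem ConvergesSmoothly.eventually_contDiffAt_inChart (h : ConvergesSmoothly m D f v)
    (hz : D ∈ 𝓝 z)
    (h1 : ∀ᶠ k in atTop, ContDiffAt ℝ ∞ (fun y => (f k y).1) z)
    (h2 : ∀ᶠ k in atTop, ContMDiffAt 𝓘(ℝ, ℂ) (𝓡 m) ∞ (fun y => (f k y).2) z) :
    ∀ᶠ k in atTop, ContDiffAt ℝ ∞ (inChart m (v z) (f k)) z := by
  filter_upwards [h1, h2, h.eventually_mem_source (mem_of_mem_nhds hz)] with k a b c
  exact contDiffAt_inChart a b c

theorem ConvergesSmoothly.tendsto_fderiv_fst (h : ConvergesSmoothly m D f v)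
    (hz : D ∈ 𝓝 z)
    (h1 : ∀ᶠ k in atTop, ContDiffAt ℝ ∞ (fun y => (f k y).1) z)
    (h2 : ∀ᶠ k in atTop, ContMDiffAt 𝓘(ℝ, ℂ) (𝓡 m) ∞ (fun y => (f k y).2) z) (ζ : ℂ) :
    Tendsto (fun k => fderiv ℝ (fun y => (f k y).1) z ζ) atTop
      (𝓝 (fderiv ℝ (fun y => (v y).1) z ζ)) := by
  have e := fderiv_fst_apply ((h.contDiffAt_inChart_limit hz).differentiableAt (by simp)) ζ
  refine Tendsto.congr' ?_ (e ▸ (continuous_fst.tendsto _).comp (h.tendsto_fderiv hz ζ))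
  filter_upwards [h.eventually_contDiffAt_inChart hz h1 h2] with k hk
  exact (fderiv_fst_apply (hk.differentiableAt (by simp)) ζ).symm

theorem ConvergesSmoothly.tendsto_density (h : ConvergesSmoothly m D f v)
    (hz : D ∈ 𝓝 z)
    (h1 : ∀ᶠ k in atTop, ContDiffAt ℝ ∞ (fun y => (f k y).1) z)
    (h2 : ∀ᶠ k in atTop, ContMDiffAt 𝓘(ℝ, ℂ) (𝓡 m) ∞ (fun y => (f k y).2) z)
    {φ : ℝ → ℝ} (hφ : ContDiff ℝ 1 φ) :
    Tendsto (fun k => density φ (fun y => (f k y).1) z) atTop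
      (𝓝 (density φ (fun y => (v y).1) z)) := by
  have t0 := h.tendsto_fst hz
  have t1 := h.tendsto_fderiv_fst hz h1 h2
  have t2 : ∀ ζ : ℂ, Tendsto (fun k => fderiv ℝ (fderiv ℝ fun y => (f k y).1) z ζ ζ) atTop
      (𝓝 (fderiv ℝ (fderiv ℝ fun y => (v y).1) z ζ ζ)) := by
    intro ζ
    have e := fderiv_fderiv_fst_apply
      ((h.contDiffAt_inChart_limit hz).of_le (by norm_cast)) ζ ζ
    refine Tendsto.congr' ?_ (e ▸ (continuous_fst.tendsto _).comp (h.tendsto_fderiv_fderiv hz ζ ζ))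
    filter_upwards [h.eventually_contDiffAt_inChart hz h1 h2] with k hk
    exact (fderiv_fderiv_fst_apply (hk.of_le (by norm_cast)) ζ ζ).symm
  have t3 := ((hφ.continuous_deriv (by norm_num)).tendsto _).comp t0
  have t4 := (hφ.continuous.tendsto _).comp t0
  exact (t3.mul (((t1 _).pow 2).add ((t1 _).pow 2))).add (t4.mul ((t2 _).add (t2 _)))

theorem ConvergesSmoothly.tendsto_lam (h : ConvergesSmoothly m D f v)
    (hz : D ∈ 𝓝 z)
    (h1 : ∀ᶠ k in atTop, ContDiffAt ℝ ∞ (fun y => (f k y).1) z)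
    (h2 : ∀ᶠ k in atTop, ContMDiffAt 𝓘(ℝ, ℂ) (𝓡 m) ∞ (fun y => (f k y).2) z)
    {lam : DiffForm m N 1} (hlam : IsSmoothForm lam) (ζ : ℂ) :
    Tendsto (fun k => lam (f k z).2 ![mfderiv 𝓘(ℝ, ℂ) (𝓡 m) (fun y => (f k y).2) z ζ]) atTop
      (𝓝 (lam (v z).2 ![mfderiv 𝓘(ℝ, ℂ) (𝓡 m) (fun y => (v y).2) z ζ])) := by
  have e1 := fderiv_snd_apply ((h.contDiffAt_inChart_limit hz).differentiableAt (by simp)) ζ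
  have t1 : Tendsto (fun k => (fderiv ℝ (inChart m (v z) (f k)) z ζ).2) atTop
      (𝓝 (fderiv ℝ (fun y => extChartAt (𝓡 m) (v z).2 (v y).2) z ζ)) :=
    e1 ▸ (continuous_snd.tendsto _).comp (h.tendsto_fderiv hz ζ)
  have t0 : Tendsto (fun k => extChartAt (𝓡 m) (v z).2 (f k z).2) atTop
      (𝓝 (extChartAt (𝓡 m) (v z).2 (v z).2)) :=
    (continuous_snd.tendsto _).comp (h.tendsto_inChart hz)
  have hη : ContinuousAt (formInChart lam (v z).2) (extChartAt (𝓡 m) (v z).2 (v z).2) :=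
    ((hlam (v z).2).contDiffAt (extChartAt_target_mem_nhds (v z).2)).continuousAt
  have t2 : Tendsto (fun k => (![(fderiv ℝ (inChart m (v z) (f k)) z ζ).2] :
      Fin 1 → EuclideanSpace ℝ (Fin m))) atTop
      (𝓝 ![fderiv ℝ (fun y => extChartAt (𝓡 m) (v z).2 (v y).2) z ζ]) := by
    rw [tendsto_pi_nhds]
    intro i
    fin_cases i
    exact t1
  have t3 := (hη.tendsto.comp t0).eval t2
  rw [formInChart_apply_fderiv ((h.contMDiffAt_snd hz).mdifferentiableAt (by simp))
    (mem_extChartAt_source _)] at t3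
  refine t3.congr' ?_
  filter_upwards [h.eventually_contDiffAt_inChart hz h1 h2, h2,
    h.eventually_mem_source (mem_of_mem_nhds hz)] with k a b c
  rw [← formInChart_apply_fderiv (b.mdifferentiableAt (by simp)) c]
  have := fderiv_snd_apply (a.differentiableAt (by simp)) ζ
  rw [← this]
  rfl

/-- Only the `∂_α` and Reeb components pass to the limit. The `ξ`-component, which contains `I`, is
not needed: these two equations already give `d lam(x_τ, x_t) = Δb`, and thereby the energy density.
-/
theorem ConvergesSmoothly.satisfiesCR (h : ConvergesSmoothly m D f v)
    (hz : D ∈ 𝓝 z)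
    (h1 : ∀ᶠ k in atTop, ContDiffAt ℝ ∞ (fun y => (f k y).1) z)
    (h2 : ∀ᶠ k in atTop, ContMDiffAt 𝓘(ℝ, ℂ) (𝓡 m) ∞ (fun y => (f k y).2) z)
    {lam : DiffForm m N 1} (hlam : IsSmoothForm lam)
    (h3 : ∀ᶠ k in atTop, SatisfiesCR lam (f k) z) : SatisfiesCR lam v z := by
  constructor
  · refine tendsto_nhds_unique_of_eventuallyEq (h.tendsto_lam hz h1 h2 hlam 1)
      (h.tendsto_fderiv_fst hz h1 h2 Complex.I).neg ?_
    filter_upwards [h3] with k hk using hk.1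
  · refine tendsto_nhds_unique_of_eventuallyEq (h.tendsto_lam hz h1 h2 hlam Complex.I)
      (h.tendsto_fderiv_fst hz h1 h2 1) ?_
    filter_upwards [h3] with k hk using hk.2

/-- The density of `v^*d(φ lam)` for a map `v` satisfying the Cauchy-Riemann equations. -/
theorem dScaled_eq_density {lam : DiffForm m N 1} (hlam : IsSmoothForm lam) (hz : D ∈ 𝓝 z)
    (h1 : ContDiffAt ℝ ∞ (fun y => (v y).1) z)
    (h2 : ContMDiffAt 𝓘(ℝ, ℂ) (𝓡 m) ∞ (fun y => (v y).2) z)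
    (h3 : ∀ᶠ y in 𝓝 z, SatisfiesCR lam v y) (φ : ℝ → ℝ) :
    dScaled φ lam (v z) (partialDPair D v z 1) (partialDPair D v z Complex.I) =
      density φ (fun y => (v y).1) z := by
  have hext := extD_eq_lap hlam h2 (h1.of_le (by norm_cast)) (h3.mono fun y hy => hy.1)
    (h3.mono fun y hy => hy.2)
  have hcr := h3.self_of_nhds
  unfold dScaled partialDPair partialD density gradSq
  rw [fderivWithin_of_mem_nhds hz, mfderivWithin_of_mem_nhds hz]
  dsimp only
  rw [hcr.1, hcr.2, hext]
  ring

end Limits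

/-! ### Affine reparametrizations and passage to the limit -/

theorem lintegral_comp_affine_le {c : ℝ} (hc : c ≠ 0) (p : ℂ) {S T : Set ℂ}
    (hS : MeasurableSet S) (hST : ∀ z ∈ S, p + c • z ∈ T) (F : ℂ → ℝ≥0∞) :
    ∫⁻ z in S, ENNReal.ofReal (c ^ 2) * F (p + c • z) ≤ ∫⁻ z in T, F z := by
  have hder : ∀ z ∈ S, HasFDerivWithinAt (fun z : ℂ => p + c • z)
      (c • ContinuousLinearMap.id ℝ ℂ) S z := fun z _ =>
    (((hasFDerivAt_id z).const_smul c).const_add p).hasFDerivWithinAt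
  have hinj : InjOn (fun z : ℂ => p + c • z) S := fun x _ y _ h =>
    smul_right_injective ℂ hc (add_left_cancel h)
  have h := lintegral_image_eq_lintegral_abs_det_fderiv_mul volume hS hder hinj F
  have hdet : (c • ContinuousLinearMap.id ℝ ℂ : ℂ →L[ℝ] ℂ).det = c ^ 2 := by
    rw [ContinuousLinearMap.det]
    change LinearMap.det (c • LinearMap.id : ℂ →ₗ[ℝ] ℂ) = c ^ 2
    rw [LinearMap.det_smul]
    simp
  rw [hdet, abs_of_nonneg (sq_nonneg c)] at h
  rw [← h]
  exact lintegral_mono_set (image_subset_iff.2 hST)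

theorem volume_im_eq (t : ℝ) : volume {z : ℂ | z.im = t} = 0 := by
  have h : {z : ℂ | z.im = t} = Complex.measurableEquivRealProd ⁻¹' (univ ×ˢ {t}) := by
    ext z; simp [Complex.measurableEquivRealProd_apply]
  rw [h, Complex.volume_preserving_equiv_real_prod.measure_preimage
    (MeasurableSet.univ.prod (measurableSet_singleton t)).nullMeasurableSet,
    Measure.volume_eq_prod, Measure.prod_prod]
  simp

namespace LagrangianPair

variable {n : ℕ} {X : Type*} [TopologicalSpace X]
  [ChartedSpace (EuclideanSpace ℝ (Fin (2 * n + 2))) X] [IsManifold (𝓡 (2 * n + 2)) ∞ X]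
  {A : Type*} {M : A → Type*} [∀ a, TopologicalSpace (M a)]
  [∀ a, ChartedSpace (EuclideanSpace ℝ (Fin (2 * n + 1))) (M a)]
  {P : LagrangianPair n X M} {a : A}

section Rescaled

variable {u : ℂ → X} {q p z : ℂ} {c : ℝ}

theorem IsStrip.contDiffAt_translated_fst (hu : P.IsStrip u) (h1 : p + c • z ∈ openStrip)
    (h2 : u (p + c • z) ∈ P.endSet a) :
    ContDiffAt ℝ ∞ (fun y => (P.translated a u q (fun y => p + c • y) y).1) z := by
  have h : ContDiffAt ℝ ∞ (fun y : ℂ => p + c • y) z := by fun_prop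
  exact (ContDiffAt.comp z (hu.contDiffAt_height h1 h2) h).sub contDiffAt_const

theorem IsStrip.contMDiffAt_base_interior (hu : P.IsStrip u) (h1 : z ∈ openStrip)
    (h2 : u z ∈ P.endSet a) :
    ContMDiffAt 𝓘(ℝ, ℂ) (𝓡 (2 * n + 1)) ∞ (fun y => P.base a (u y)) z :=
  (hu.contMDiffWithinAt_base (openStrip_subset_strip h1) h2).contMDiffAt (strip_mem_nhds h1)

theorem IsStrip.contMDiffAt_translated_snd (hu : P.IsStrip u) (h1 : p + c • z ∈ openStrip)
    (h2 : u (p + c • z) ∈ P.endSet a) :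
    ContMDiffAt 𝓘(ℝ, ℂ) (𝓡 (2 * n + 1)) ∞
      (fun y => (P.translated a u q (fun y => p + c • y) y).2) z := by
  have h : ContDiffAt ℝ ∞ (fun y : ℂ => p + c • y) z := by fun_prop
  exact ContMDiffAt.comp (f := fun y : ℂ => p + c • y) z
    (hu.contMDiffAt_base_interior h1 h2) h.contMDiffAt

/-- Both equations are linear in the first derivatives, which all acquire the factor `c`;
translating `α` has no effect on them. -/
theorem IsStrip.satisfiesCR_translated (hu : P.IsStrip u) (h1 : p + c • z ∈ openStrip)
    (h2 : u (p + c • z) ∈ P.endSet a) :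
    SatisfiesCR (P.lam a) (P.translated a u q fun y => p + c • y) z := by
  have hder : HasMFDerivAt 𝓘(ℝ, ℂ) 𝓘(ℝ, ℂ) (fun y : ℂ => p + c • y) z
      (c • ContinuousLinearMap.id ℝ ℂ) :=
    (((hasFDerivAt_id z).const_smul c).const_add p).hasMFDerivAt
  have hb := (hu.contMDiffAt_base_interior h1 h2).mdifferentiableAt (by simp)
  have hcomp := HasMFDerivAt.comp z hb.hasMFDerivAt hder
  let B : ℂ →L[ℝ] EuclideanSpace ℝ (Fin (2 * n + 1)) :=
    mfderiv 𝓘(ℝ, ℂ) (𝓡 (2 * n + 1)) (fun y => P.base a (u y)) (p + c • z)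
  have hx : ∀ ζ : ℂ, mfderiv 𝓘(ℝ, ℂ) (𝓡 (2 * n + 1))
      (fun y => (P.translated a u q (fun y => p + c • y) y).2) z ζ = c • B ζ := by
    intro ζ
    have := congrArg (fun L : ℂ →L[ℝ] EuclideanSpace ℝ (Fin (2 * n + 1)) => L ζ) hcomp.mfderiv
    refine this.trans ?_
    exact B.map_smul c ζ
  have hg : ∀ ζ : ℂ, fderiv ℝ (fun y => (P.translated a u q (fun y => p + c • y) y).1) z ζ =
      c * fderiv ℝ (fun y => P.height a (u y)) (p + c • z) ζ := fun ζ =>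
    congrArg (fun L : ℂ →L[ℝ] ℝ => L ζ)
      (fderiv_comp_affine (fun y => P.height a (u y)) c (P.height a (u q)) p z)
  have hcr := hu.cauchyRiemann (openStrip_subset_strip h1) h2
  have hpd : ∀ ζ : ℂ, partialD (2 * n + 1) strip (fun y => P.base a (u y)) (p + c • z) ζ = B ζ := by
    intro ζ
    rw [partialD, mfderivWithin_of_mem_nhds (strip_mem_nhds h1)]
    rfl
  rw [hpd, hpd, fderivWithin_of_mem_nhds (strip_mem_nhds h1)] at hcr
  constructor
  · rw [hx, hg, ← mul_neg, ← hcr.1]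
    exact oneForm_smul (P.lam a (P.base a (u (p + c • z)))) c _
  · rw [hx, hg, ← hcr.2.1]
    exact oneForm_smul (P.lam a (P.base a (u (p + c • z)))) c _

theorem IsStrip.density_translated (φ : ℝ → ℝ) :
    density φ (fun y => (P.translated a u q (fun y => p + c • y) y).1) z =
      c ^ 2 * density (fun s => φ (s - P.height a (u q))) (fun y => P.height a (u y))
        (p + c • z) :=
  density_comp_affine φ (fun y => P.height a (u y)) c (P.height a (u q)) p z

end Rescaled

variable [∀ a, IsManifold (𝓡 (2 * n + 1)) ∞ (M a)]

/-- The Hofer energy estimate for limits of affine reparametrizations `z ↦ p k + c k z`. -/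
theorem hoferEnergy_le_of_convergesSmoothly {u : ℕ → ℂ → X} (hu : ∀ k, P.IsStrip (u k))
    {C : ℝ≥0} (henergy : ∀ k, symplecticEnergy P.Om (u k) ≤ C) {q p : ℕ → ℂ} {c : ℕ → ℝ}
    (hc : ∀ k, c k ≠ 0) {D O : Set ℂ} (hO : IsOpen O) (hOD : O ⊆ D) (hnull : volume (D \ O) = 0)
    (hbot : Tendsto (fun k => P.height a (u k (q k))) atTop atBot)
    (hmem : ∀ z ∈ O, ∀ᶠ k in atTop,
      p k + c k • z ∈ openStrip ∧ u k (p k + c k • z) ∈ P.endSet a)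
    {v : ℂ → ℝ × M a}
    (hlim : ConvergesSmoothly (2 * n + 1) D
      (fun k => P.translated a (u k) (q k) fun z => p k + c k • z) v) :
    hoferEnergy (P.lam a) D v ≤ ENNReal.ofReal (Real.exp (-P.R a)) * C := by
  set f : ℕ → ℂ → ℝ × M a := fun k => P.translated a (u k) (q k) fun z => p k + c k • z with hf
  have hDn : ∀ z ∈ O, D ∈ 𝓝 z := fun z hz => mem_of_superset (hO.mem_nhds hz) hOD
  have h1 : ∀ z ∈ O, ∀ᶠ k in atTop, ContDiffAt ℝ ∞ (fun y => (f k y).1) z := fun z hz =>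
    (hmem z hz).mono fun k hk => (hu k).contDiffAt_translated_fst hk.1 hk.2
  have h2 : ∀ z ∈ O, ∀ᶠ k in atTop,
      ContMDiffAt 𝓘(ℝ, ℂ) (𝓡 (2 * n + 1)) ∞ (fun y => (f k y).2) z := fun z hz =>
    (hmem z hz).mono fun k hk => (hu k).contMDiffAt_translated_snd hk.1 hk.2
  have hcr : ∀ z ∈ O, SatisfiesCR (P.lam a) v z := fun z hz =>
    hlim.satisfiesCR (hDn z hz) (h1 z hz) (h2 z hz) (P.contact a).smooth
      ((hmem z hz).mono fun k hk => (hu k).satisfiesCR_translated hk.1 hk.2)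
  refine iSup₂_le fun φ hφ => ?_
  have hφ1 : ContDiff ℝ 1 φ := hφ.1.of_le (by norm_cast)
  have hdens : ∀ z ∈ O,
      dScaled φ (P.lam a) (v z) (partialDPair D v z 1) (partialDPair D v z Complex.I) =
        density φ (fun y => (v y).1) z := fun z hz =>
    dScaled_eq_density (P.contact a).smooth (hDn z hz) (hlim.contDiffAt_fst (hDn z hz))
      (hlim.contMDiffAt_snd (hDn z hz)) (eventually_of_mem (hO.mem_nhds hz) hcr) φ
  have hae : D =ᵐ[volume] O :=
    (ae_le_set.2 hnull).antisymm (LE.le.eventuallyLE hOD)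
  rw [setLIntegral_congr hae, setLIntegral_congr_fun hO.measurableSet
    (g := fun z => ENNReal.ofReal (density φ (fun y => (v y).1) z))
    (fun z hz => congrArg ENNReal.ofReal (hdens z hz))]
  -- The estimate for a single strip holds for levels strictly below `R`; the sharp constant follows
  -- by letting `d` increase to `R`.
  suffices hd : ∀ d < P.R a, ∫⁻ z in O, ENNReal.ofReal (density φ (fun y => (v y).1) z) ≤
      ENNReal.ofReal (Real.exp (-d)) * C by
    have ht : Tendsto (fun d : ℝ => ENNReal.ofReal (Real.exp (-d)) * C) (𝓝[<] P.R a)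
        (𝓝 (ENNReal.ofReal (Real.exp (-P.R a)) * C)) := by
      refine ENNReal.Tendsto.mul_const (ENNReal.tendsto_ofReal ?_) (Or.inr ENNReal.coe_ne_top)
      exact ((by fun_prop : Continuous fun d : ℝ => Real.exp (-d)).tendsto _).mono_left
        nhdsWithin_le_nhds
    exact ge_of_tendsto ht (eventually_of_mem self_mem_nhdsWithin hd)
  intro d hd
  -- The slab reaches down to `k` below the height of the centre. For fixed `z` the translated
  -- height converges, so it eventually exceeds `-k`; the true height tends to `-∞`, so it
  -- eventually lies below `d`. Hence each point of `O` is eventually in `S k`.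
  let S : ℕ → Set ℂ := fun k => O ∩ (fun z => p k + c k • z) ⁻¹'
    P.slab a (u k) (P.height a (u k (q k)) - k) d
  have hSo : ∀ k, IsOpen (S k) := fun k =>
    hO.inter (((hu k).isOpen_slab a _ d).preimage (by fun_prop))
  let F : ℕ → ℂ → ℝ≥0∞ := fun k =>
    (S k).indicator fun z => ENNReal.ofReal (density φ (fun y => (f k y).1) z)
  have hFm : ∀ k, AEMeasurable (F k) (volume.restrict O) := by
    intro k
    refine AEMeasurable.restrict ?_
    rw [aemeasurable_indicator_iff (hSo k).measurableSet]
    refine AEMeasurable.ennreal_ofReal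
      (ContinuousOn.aemeasurable (fun z hz => ?_) (hSo k).measurableSet)
    exact (ContDiffAt.continuousAt_density hφ1
      (((hu k).contDiffAt_translated_fst hz.2.1.1 hz.2.1.2).of_le
        (by norm_cast))).continuousWithinAt
  have hFlim : ∀ z ∈ O, Tendsto (fun k => F k z) atTop
      (𝓝 (ENNReal.ofReal (density φ (fun y => (v y).1) z))) := by
    intro z hz
    refine (ENNReal.tendsto_ofReal
      (hlim.tendsto_density (hDn z hz) (h1 z hz) (h2 z hz) hφ1)).congr' ?_
    have hb := hlim.tendsto_fst (hDn z hz)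
    have hlo : ∀ᶠ k : ℕ in atTop, -(k : ℝ) < (f k z).1 := by
      filter_upwards [hb.eventually (lt_mem_nhds (sub_one_lt (v z).1)),
        (tendsto_neg_atTop_atBot.comp tendsto_natCast_atTop_atTop).eventually
          (eventually_lt_atBot ((v z).1 - 1))] with k hk hk'
      exact lt_trans hk' hk
    have hhi : ∀ᶠ k : ℕ in atTop, (f k z).1 + P.height a (u k (q k)) < d :=
      (hb.add_atBot hbot).eventually (eventually_lt_atBot d)
    filter_upwards [hmem z hz, hlo, hhi] with k hk hk1 hk2
    have hfk : (f k z).1 = P.height a (u k (p k + c k • z)) - P.height a (u k (q k)) := rfl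
    refine (indicator_of_mem (s := S k) (f := fun z => ENNReal.ofReal
      (density φ (fun y => (f k y).1) z)) ⟨hz, hk, ?_, ?_⟩).symm
    · rw [hfk] at hk1
      change _ < P.height a (u k (p k + c k • z))
      linarith
    · rw [hfk] at hk2
      change P.height a (u k (p k + c k • z)) < _
      linarith
  have hFbound : ∀ k, ∫⁻ z in O, F k z ≤ ENNReal.ofReal (Real.exp (-d)) * C := by
    intro k
    calc ∫⁻ z in O, F k z ≤ ∫⁻ z, F k z := setLIntegral_le_lintegral _ _
      _ = ∫⁻ z in S k, ENNReal.ofReal (density φ (fun y => (f k y).1) z) :=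
        lintegral_indicator (hSo k).measurableSet _
      _ = ∫⁻ z in S k, ENNReal.ofReal (c k ^ 2) * ENNReal.ofReal
            (density (fun s => φ (s - P.height a (u k (q k))))
              (fun y => P.height a (u k y)) (p k + c k • z)) := by
          refine setLIntegral_congr_fun (hSo k).measurableSet fun z _ => ?_
          rw [← ENNReal.ofReal_mul (sq_nonneg _)]
          exact congrArg ENNReal.ofReal (IsStrip.density_translated φ)
      _ ≤ ∫⁻ z in P.slab a (u k) (P.height a (u k (q k)) - k) d, ENNReal.ofReal
            (density (fun s => φ (s - P.height a (u k (q k)))) (fun y => P.height a (u k y)) z) :=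
          lintegral_comp_affine_le (hc k) (p k) (hSo k).measurableSet (fun z hz => hz.2)
            (fun z => ENNReal.ofReal (density (fun s => φ (s - P.height a (u k (q k))))
              (fun y => P.height a (u k y)) z))
      _ ≤ ENNReal.ofReal (Real.exp (-d)) * symplecticEnergy P.Om (u k) :=
          (hu k).lintegral_density_le hφ hd
      _ ≤ _ := by gcongr; exact henergy k
  -- Fatou's lemma: the truncated densities converge pointwise on `O`, and their integrals are
  -- uniformly bounded.
  calc ∫⁻ z in O, ENNReal.ofReal (density φ (fun y => (v y).1) z)
      = ∫⁻ z in O, liminf (fun k => F k z) atTop :=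
        setLIntegral_congr_fun hO.measurableSet fun z hz => (hFlim z hz).liminf_eq.symm
    _ ≤ liminf (fun k => ∫⁻ z in O, F k z) atTop := lintegral_liminf_le' hFm
    _ ≤ _ := (liminf_le_liminf (Eventually.of_forall hFbound)).trans_eq (by simp)

end LagrangianPair

/-! ### The four kinds of rescaling -/

theorem isOpen_upperHalfPlane : IsOpen {z : ℂ | 0 < z.im} :=
  isOpen_lt continuous_const Complex.continuous_im

theorem upperHalfPlane_subset_halfPlane : {z : ℂ | 0 < z.im} ⊆ halfPlane := fun z hz =>
  show 0 ≤ z.im from le_of_lt hz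

theorem volume_halfPlane_diff : volume (halfPlane \ {z : ℂ | 0 < z.im}) = 0 :=
  measure_mono_null (fun _ hz => le_antisymm (not_lt.1 hz.2) hz.1) (volume_im_eq 0)

theorem volume_strip_diff : volume (strip \ openStrip) = 0 := by
  refine measure_mono_null (t := {z : ℂ | z.im = 0} ∪ {z : ℂ | z.im = 1}) (fun z hz => ?_)
    (measure_union_null (volume_im_eq 0) (volume_im_eq 1))
  by_contra h
  rw [mem_union, not_or] at h
  exact hz.2 ⟨lt_of_le_of_ne hz.1.1 (Ne.symm h.1), lt_of_le_of_ne hz.1.2 h.2⟩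

/-- If `δ k → 0` and `δ k * m k → ∞` with `δ k, m k > 0` then `m k → ∞`. -/
theorem tendsto_atTop_of_mul_tendsto_atTop {δ m : ℕ → ℝ} (hδ : Tendsto δ atTop (𝓝 0))
    (hm : ∀ k, 0 < m k) (h : Tendsto (fun k => δ k * m k) atTop atTop) :
    Tendsto m atTop atTop := by
  refine tendsto_atTop_mono' atTop ?_ h
  filter_upwards [hδ.eventually (gt_mem_nhds one_pos)] with k hk
  exact mul_le_of_le_one_left (hm k).le hk.le

theorem dist_lt_of_mul_lt {m δ b : ℝ} (hm : 0 < m) {x y : ℂ} (h : m * dist x y ≤ b)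
    (hb : b < δ * m) : dist x y < δ :=
  lt_of_mul_lt_mul_left (by linarith [mul_comm δ m]) hm.le

/-- Applied with `t` the distance of the centre `q` from the relevant boundary line, this bounds,
after magnification by `m`, the distance from `q` to a point reparametrized about the foot of `q` on
that line. -/
theorem norm_add_I_mul_le {m t B : ℝ} (hm : 0 < m) (ht : 0 ≤ t) (hB : t * m ≤ B) (z : ℂ) :
    m * ‖(m⁻¹ : ℝ) • z - (t : ℂ) * Complex.I‖ ≤ ‖z‖ + B := by
  have h1 : ‖(m⁻¹ : ℝ) • z - (t : ℂ) * Complex.I‖ ≤ m⁻¹ * ‖z‖ + t := by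
    refine (norm_sub_le _ _).trans (le_of_eq ?_)
    rw [norm_smul, norm_mul, Complex.norm_I, Complex.norm_real, Real.norm_of_nonneg ht,
      Real.norm_of_nonneg (inv_nonneg.2 hm.le), mul_one]
  calc m * ‖(m⁻¹ : ℝ) • z - (t : ℂ) * Complex.I‖ ≤ m * (m⁻¹ * ‖z‖ + t) := by gcongr
    _ = ‖z‖ + t * m := by field_simp
    _ ≤ _ := by gcongr

namespace LagrangianPair

variable {n : ℕ} {X : Type*} [TopologicalSpace X]
  [ChartedSpace (EuclideanSpace ℝ (Fin (2 * n + 2))) X] [IsManifold (𝓡 (2 * n + 2)) ∞ X]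
  {A : Type*} {M : A → Type*} [∀ a, TopologicalSpace (M a)]
  [∀ a, ChartedSpace (EuclideanSpace ℝ (Fin (2 * n + 1))) (M a)]
  [∀ a, IsManifold (𝓡 (2 * n + 1)) ∞ (M a)]
  {P : LagrangianPair n X M} {a : A}

/-- The Hofer energy of a limit of strips in the end `a` is at most `e^(-R)` times a bound for their
symplectic energies. Nothing is needed about the behaviour of the strips as `τ → ±∞`: the boundary
terms there are controlled by the boundedness of the primitive `profilePrimitive`. -/
theorem IsLimitOfSequence.hoferEnergy_le {u : ℕ → ℂ → X} (hu : ∀ k, P.IsStrip (u k))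
    {C : ℝ≥0} (hE : ∀ k, symplecticEnergy P.Om (u k) ≤ C) {D : Set ℂ} {v : ℂ → ℝ × M a}
    (hlim : P.IsLimitOfSequence a u v D) :
    hoferEnergy (P.lam a) D v ≤ ENNReal.ofReal (Real.exp (-P.R a)) * C := by
  cases hlim with
  | plane q δ m hq interior hδ hm hδm lim =>
    have hφ : ∀ k, (fun z : ℂ => q k + z / (m k : ℂ)) = fun z => q k + (m k)⁻¹ • z := by
      intro k; funext z; rw [Complex.real_smul]; push_cast; ring
    simp only [hφ] at lim
    refine hoferEnergy_le_of_convergesSmoothly hu hE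
      (fun k => inv_ne_zero (hm k).ne') isOpen_univ subset_rfl (by simp) hq.tendsto
      (fun z _ => ?_) lim
    filter_upwards [hδm.eventually_gt_atTop ‖z‖] with k hk
    have hd : dist (q k + (m k)⁻¹ • z) (q k) < δ k := by
      refine dist_lt_of_mul_lt (hm k) (le_of_eq ?_) hk
      rw [dist_eq_norm, add_sub_cancel_left, norm_smul,
        Real.norm_of_nonneg (inv_nonneg.2 (hm k).le), mul_inv_cancel_left₀ (hm k).ne']
    have hmem : q k + (m k)⁻¹ • z ∈ openStrip := interior k _ hd
    exact ⟨hmem, hq.mem_end k _ (openStrip_subset_strip hmem) hd⟩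
  | lower q δ m hq hδ hm hδm near lim =>
    obtain ⟨B, hB⟩ := near
    have hφ : ∀ k, (fun z : ℂ => ((q k).re : ℂ) + z / (m k : ℂ)) =
        fun z => ((q k).re : ℂ) + (m k)⁻¹ • z := by
      intro k; funext z; rw [Complex.real_smul]; push_cast; ring
    simp only [hφ] at lim
    refine hoferEnergy_le_of_convergesSmoothly hu hE
      (fun k => inv_ne_zero (hm k).ne') isOpen_upperHalfPlane upperHalfPlane_subset_halfPlane
      volume_halfPlane_diff hq.tendsto (fun z hz => ?_) lim
    -- The first condition puts the rescaled point in the disc about `q k`; the second, `z.im < m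
    -- k`, keeps it below the line `t = 1`.
    filter_upwards [hδm.eventually_gt_atTop (‖z‖ + B),
      (tendsto_atTop_of_mul_tendsto_atTop hδ hm hδm).eventually_gt_atTop z.im] with k hk hk'
    have hd : dist (((q k).re : ℂ) + (m k)⁻¹ • z) (q k) < δ k := by
      refine dist_lt_of_mul_lt (hm k) ?_ hk
      refine le_trans (le_of_eq ?_) (norm_add_I_mul_le (hm k) (hq.mem_strip k).1 (hB k) z)
      rw [dist_eq_norm]
      congr 2
      nth_rewrite 2 [← Complex.re_add_im (q k)]
      ring
    have him : (((q k).re : ℂ) + (m k)⁻¹ • z).im = z.im / m k := by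
      rw [Complex.add_im, Complex.ofReal_im, Complex.smul_im, smul_eq_mul, zero_add, div_eq_inv_mul]
    have hmem : ((q k).re : ℂ) + (m k)⁻¹ • z ∈ openStrip := by
      change _ ∈ Ioo (0 : ℝ) 1
      rw [him]
      exact ⟨div_pos hz (hm k), (div_lt_one (hm k)).2 hk'⟩
    exact ⟨hmem, hq.mem_end k _ (openStrip_subset_strip hmem) hd⟩
  | upper q δ m hq hδ hm hδm near lim =>
    obtain ⟨B, hB⟩ := near
    -- At the upper line the half plane is turned by a half rotation, so the scaling factor is `-1 /
    -- m k`.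
    have hφ : ∀ k, (fun z : ℂ => ((q k).re : ℂ) + Complex.I - z / (m k : ℂ)) =
        fun z => (((q k).re : ℂ) + Complex.I) + (-(m k)⁻¹) • z := by
      intro k; funext z; rw [Complex.real_smul]; push_cast; ring
    simp only [hφ] at lim
    refine hoferEnergy_le_of_convergesSmoothly hu hE
      (fun k => neg_ne_zero.2 (inv_ne_zero (hm k).ne')) isOpen_upperHalfPlane
      upperHalfPlane_subset_halfPlane volume_halfPlane_diff hq.tendsto (fun z hz => ?_) lim
    filter_upwards [hδm.eventually_gt_atTop (‖z‖ + B),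
      (tendsto_atTop_of_mul_tendsto_atTop hδ hm hδm).eventually_gt_atTop z.im] with k hk hk'
    have hd : dist (((q k).re : ℂ) + Complex.I + (-(m k)⁻¹) • z) (q k) < δ k := by
      refine dist_lt_of_mul_lt (hm k) ?_ hk
      refine le_trans (le_of_eq ?_)
        (norm_add_I_mul_le (hm k) (sub_nonneg.2 (hq.mem_strip k).2) (hB k) z)
      rw [dist_eq_norm, ← norm_neg]
      congr 2
      nth_rewrite 2 [← Complex.re_add_im (q k)]
      rw [neg_smul]
      push_cast
      ring
    have him : (((q k).re : ℂ) + Complex.I + (-(m k)⁻¹) • z).im = 1 - z.im / m k := by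
      rw [Complex.add_im, Complex.add_im, Complex.ofReal_im, Complex.I_im, Complex.smul_im,
        smul_eq_mul, zero_add, div_eq_inv_mul]
      ring
    have hmem : ((q k).re : ℂ) + Complex.I + (-(m k)⁻¹) • z ∈ openStrip := by
      change _ ∈ Ioo (0 : ℝ) 1
      rw [him]
      have h1 : 0 < z.im / m k := div_pos hz (hm k)
      have h2 : z.im / m k < 1 := (div_lt_one (hm k)).2 hk'
      constructor <;> linarith
    exact ⟨hmem, hq.mem_end k _ (openStrip_subset_strip hmem) hd⟩
  | translation q δ hq hδ lim =>
    have hφ : ∀ k, (fun z : ℂ => z + ((q k).re : ℂ)) =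
        fun z => ((q k).re : ℂ) + (1 : ℝ) • z := by
      intro k; funext z; rw [one_smul, add_comm]
    simp only [hφ] at lim
    refine hoferEnergy_le_of_convergesSmoothly hu hE
      (fun k => one_ne_zero) isOpen_openStrip openStrip_subset_strip
      volume_strip_diff hq.tendsto (fun z hz => ?_) lim
    -- The translation uses the real part of `q k` only; its imaginary part adds at most `1` to the
    -- distance.
    filter_upwards [hδ.eventually_gt_atTop (‖z‖ + 1)] with k hk
    have hd : dist (((q k).re : ℂ) + (1 : ℝ) • z) (q k) < δ k := by
      refine dist_lt_of_mul_lt one_pos ?_ (by rwa [mul_one])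
      refine le_trans (le_of_eq ?_) (norm_add_I_mul_le one_pos (hq.mem_strip k).1
        (by rw [mul_one]; exact (hq.mem_strip k).2) z)
      rw [dist_eq_norm, inv_one]
      congr 2
      nth_rewrite 2 [← Complex.re_add_im (q k)]
      ring
    have hmem : ((q k).re : ℂ) + (1 : ℝ) • z ∈ openStrip := by
      change _ ∈ Ioo (0 : ℝ) 1
      have : (((q k).re : ℂ) + (1 : ℝ) • z).im = z.im := by simp
      rw [this]
      exact hz
    exact ⟨hmem, hq.mem_end k _ (openStrip_subset_strip hmem) hd⟩

end LagrangianPair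

end ConcaveEnds

end

theorem proposition5p11 {n : ℕ} {X : Type*} [TopologicalSpace X] [T2Space X]
    [SecondCountableTopology X] [ChartedSpace (EuclideanSpace ℝ (Fin (2 * n + 2))) X]
    [IsManifold (𝓡 (2 * n + 2)) ∞ X]
    {A : Type*} {M : A → Type*} [∀ a, TopologicalSpace (M a)] [∀ a, T2Space (M a)]
    [∀ a, CompactSpace (M a)] [∀ a, ChartedSpace (EuclideanSpace ℝ (Fin (2 * n + 1))) (M a)]
    [∀ a, IsManifold (𝓡 (2 * n + 1)) ∞ (M a)]
    (P : ConcaveEnds.LagrangianPair n X M)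
    (u : ℕ → ℂ → X) (hstrip : ∀ i, P.IsStrip (u i))
    (htype : ∀ i, P.IsTypeI (u i) ∨ P.IsTypeII (u i) ∨ P.IsTypeII' (u i) ∨ P.IsTypeIII (u i))
    (C : ℝ≥0) (henergy : ∀ i, ConcaveEnds.symplecticEnergy P.Om (u i) ≤ (C : ℝ≥0∞))
    (a : A) (D : Set ℂ) (v : ℂ → ℝ × M a) (hv : P.IsLimit a u D v) :
    ConcaveEnds.hoferEnergy (P.lam a) D v ≤ ENNReal.ofReal (Real.exp (-P.R a)) * (C : ℝ≥0∞) := by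
  obtain ⟨s, -, hlim⟩ := hv
  exact hlim.hoferEnergy_le (fun k => hstrip (s k)) fun k => henergy (s k)
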